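/- Let $s\in(0,1]$, $\lambda>0$ and $0<\varepsilon<\lambda/(2\pi)$. Let $(-\partial_{xx})^{-s}\rho=W*\rho$ denote the Riesz potential on $\mathbb{R}$, with kernel $W(x)=c_{1,s}|x|^{2s-1}$, $c_{1,s}=\dfrac{s\,2^{-2s}\,\Gamma(1/2-s)}{\pi^{1/2}\,\Gamma(1+s)}$ if $s\neq 1/2$, and $W(x)=-\frac1\pi\log|x|$ if $s=1/2$. Let $\mathcal{P}_2(\mathbb{R})$ be the set of Borel probability measures on $\mathbb{R}$ with finite second moment, and $W_2$ the quadratic Wasserstein distance on it. For $\mu\in\mathcal{P}_2(\mathbb{R})$ put \[ \mathcal{E}(\mu)=\frac12\iint W(x-y)\,d\mu(x)\,d\mu(y)+\frac{\lambda}{2}\int x^2\,d\mu(x)\in(-\infty,+\infty], \qquad \mathcal{E}_\varepsilon(\mu)=\mathcal{E}(\mu)+\varepsilon\int\rho\log\rho\,dx , \] where $\rho$ is the Lebesgue density of $\mu$, and the entropy $\int\rho\log\rho$ is $+\infty$ if $\mu$ is not absolutely continuous. Absolutely continuous measures are identified with their densities. For a continuous density $\rho$ put \[ \mathcal{I}_\varepsilon(\rho)=\int_{\mathbb{R}}\bigl|\partial_x(-\partial_{xx})^{-s}\rho+\lambda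 x+\varepsilon\,\partial_x\log\rho\bigr|^2\rho\,dx\in[0,+\infty] \] if $\rho$ is locally absolutely continuous, and $\mathcal{I}_\varepsilon(\rho)=+\infty$ otherwise. Let $\rho\in L^1(\mathbb{R})\cap L^\infty(\mathbb{R})\cap C^\alpha(\mathbb{R})$ be nonnegative with $\int\rho\,dx=1$ and $\int x^2\rho\,dx<\infty$, where $\alpha\ge 0$ and $\alpha>1-2s$ ($C^\alpha$ means globally $\alpha$-Hölder continuous, and just continuous if $\alpha=0$). Let $\rho_\infty^\varepsilon$ be a minimum point of $\mathcal{E}_\varepsilon$ on $\mathcal{P}_2(\mathbb{R})$. Then $\mathcal{E}_\varepsilon(\rho)$ and $\mathcal{E}_\varepsilon(\rho_\infty^\varepsilon)$ are finite, and, with the convention $\infty\cdot 0=0$, the HWI inequality \[ \mathcal{E}_\varepsilon(\rho)-\mathcal{E}_\varepsilon(\rho_\infty^\varepsilon)\le\sqrt{\mathcal{I}_\varepsilon(\rho)}\;W_2(\rho,\rho_\infty^\varepsilon)-\frac{\lambda}{2}W_2^2(\rho,\rho_\infty^\varepsilon), \] the logarithmic Sobolev inequality \[ \mathcal{E}_\varepsilon(\rho)-\mathcal{E}_\varepsilon(\rho_\infty^\varepsilon)\le\frac{1}{2\lambda}\,\mathcal{I}_\varepsilon(\rho),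 \] and the Talagrand inequality \[ W_2(\rho,\rho_\infty^\varepsilon)\le\sqrt{\frac{2}{\lambda}\bigl(\mathcal{E}_\varepsilon(\rho)-\mathcal{E}_\varepsilon(\rho_\infty^\varepsilon)\bigr)} \] hold. -/

import Mathlib

open MeasureTheory
open scoped ENNReal NNReal

noncomputable section

namespace FracPressure

/-- The constant `c_{1,s} = s 2^{-2s} Γ(1/2 - s) / (π^{1/2} Γ(1 + s))` of the one-dimensional
Riesz kernel (`s ≠ 1/2`). It is positive for `s < 1/2` and negative for `1/2 < s ≤ 1`. -/
def rieszConst (s : ℝ) : ℝ :=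
  s * (2 : ℝ) ^ (-2 * s) * Real.Gamma (1 / 2 - s) / (Real.sqrt Real.pi * Real.Gamma (1 + s))

/-- The convolution kernel of `(-∂ₓₓ)^{-s}` on the line: `c_{1,s} |x|^{2s-1}` for `s ≠ 1/2`, and the
logarithmic kernel `-(1/π) log |x|` for `s = 1/2`. -/
def rieszKernel (s x : ℝ) : ℝ :=
  if s = 1 / 2 then -(1 / Real.pi) * Real.log |x| else rieszConst s * |x| ^ (2 * s - 1)

/-- The pressure `(-∂ₓₓ)^{-s} ρ`, the Riesz potential of the density `ρ`. -/
def rieszPotential (s : ℝ) (ρ : ℝ → ℝ) (x : ℝ) : ℝ :=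
  ∫ y, rieszKernel s (x - y) * ρ y

/-- The measure `ρ(x) dx` with density `ρ`. -/
def densityMeasure (ρ : ℝ → ℝ) : Measure ℝ :=
  (volume : Measure ℝ).withDensity fun x => ENNReal.ofReal (ρ x)

/-- Membership in `𝒫₂(ℝ)`: probability measures with finite second moment. -/
def MemP2 (μ : Measure ℝ) : Prop :=
  IsProbabilityMeasure μ ∧ Integrable (fun x : ℝ => x ^ 2) μ

open Classical in
/-- The energy `ℰ(μ) = (1/2) ∬ W(x - y) dμ(x) dμ(y) + (λ/2) ∫ x² dμ(x)` with the Riesz kernel `W`,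
as an extended real. On `𝒫₂(ℝ)` the negative part of the integrand is always integrable, so
non-integrability means that the energy is `+∞`. For `s ≤ 1/2` the kernel is `+∞` at the origin,
so that the energy of a measure with an atom is `+∞`; the clause on atoms accounts for this. -/
def energy (s lam : ℝ) (μ : Measure ℝ) : EReal :=
  if Integrable (fun x : ℝ => x ^ 2) μ ∧
      Integrable (fun p : ℝ × ℝ => rieszKernel s (p.1 - p.2)) (μ.prod μ) ∧
      (s ≤ 1 / 2 → ∀ x : ℝ, μ {x} = 0) then
    (((1 / 2) * (∫ p : ℝ × ℝ, rieszKernel s (p.1 - p.2) ∂(μ.prod μ))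
      + (lam / 2) * (∫ x, x ^ 2 ∂μ) : ℝ) : EReal)
  else ⊤

open Classical in
/-- The entropy `∫ ρ log ρ` of a measure with Lebesgue density `ρ`, and `+∞` for a measure that is
not absolutely continuous. On `𝒫₂(ℝ)` the negative part of `ρ log ρ` is always integrable, so
non-integrability means that the entropy is `+∞`. -/
def entropy (μ : Measure ℝ) : EReal :=
  if μ ≪ volume ∧
      Integrable (fun x => (μ.rnDeriv volume x).toReal * Real.log (μ.rnDeriv volume x).toReal)
        volume then
    ((∫ x, (μ.rnDeriv volume x).toReal * Real.log (μ.rnDeriv volume x).toReal : ℝ) : EReal)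
  else ⊤

/-- The entropy-regularized energy `ℰ_ε = ℰ + ε ∫ ρ log ρ`. -/
def regEnergy (s lam eps : ℝ) (μ : Measure ℝ) : EReal :=
  energy s lam μ + (eps : EReal) * entropy μ

/-- `μ` is a minimum point of `ℰ_ε` on `𝒫₂(ℝ)`. -/
def IsRegMinimizer (s lam eps : ℝ) (μ : Measure ℝ) : Prop :=
  MemP2 μ ∧ ∀ ν : Measure ℝ, MemP2 ν → regEnergy s lam eps μ ≤ regEnergy s lam eps ν

open Classical in
/-- The energy dissipation `ℐ_ε(ρ) = ∫ |∂ₓ(-∂ₓₓ)^{-s}ρ + λ x + ε ∂ₓ log ρ|² ρ dx`, for a continuous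
density `ρ`. It is `+∞` unless `ρ` is locally absolutely continuous, that is, unless the continuous
function `ρ` has a locally integrable weak derivative, which is then its derivative almost
everywhere. -/
def dissipation (s lam eps : ℝ) (ρ : ℝ → ℝ) : ℝ≥0∞ :=
  if ∀ a b : ℝ, AbsolutelyContinuousOnInterval ρ a b then
    ∫⁻ x, ENNReal.ofReal
      ((deriv (rieszPotential s ρ) x + lam * x + eps * deriv (fun y => Real.log (ρ y)) x) ^ 2 * ρ x)
  else ⊤

/-- The set `Π(μ, ν)` of measures on `ℝ × ℝ` with marginals `μ` and `ν`. -/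
def couplings (μ ν : Measure ℝ) : Set (Measure (ℝ × ℝ)) :=
  {γ | γ.map Prod.fst = μ ∧ γ.map Prod.snd = ν}

/-- The quadratic Wasserstein distance `W₂(μ, ν)`. -/
def W2 (μ ν : Measure ℝ) : ℝ≥0∞ :=
  (⨅ γ ∈ couplings μ ν, ∫⁻ p : ℝ × ℝ, ENNReal.ofReal (|p.1 - p.2| ^ 2) ∂γ) ^ (1 / 2 : ℝ)

end FracPressure

end

open FracPressure

/-!
All three inequalities come from the convexity of `ℰ_ε` along the monotone rearrangement of the
line.

For an atomless `μ` the map `T = F_ν⁻¹ ∘ F_μ` (`monotoneMap`) pushes `μ` forward to `ν`, and it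
realises `W₂(μ, ν)` because a primitive of `T` is a Kantorovich potential (`W2_eq_ofReal_sqrt`).
Since `T` is nondecreasing, `x - y` and `T x - T y` have the same sign, so that only the convexity
of the kernel `W` on the half-line `(0, ∞)` matters for the interaction energy. This holds for every
`s ∈ (0, 1]`: on that half-line `W'(z) = -k z ^ (2 s - 2)` with `k > 0` (`hasDerivAt_rieszKernel`).
The Monge–Ampère equation `g(T(x)) T'(x) = f(x)` between the densities (`ae_mongeAmpere`) turns the
entropy of `ν` into `∫ (log f - log T') dμ`, convex in `T'`, and the confinement is a quadratic
form.

*HWI.* With `μ = ρ dx` and `ν` the minimiser, each of the three parts of the energy lies above its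
tangent at `μ`.
For the interaction (`interaction_tangent_le`) the singular kernel is replaced by `W(|z| + δ)`,
whose force is bounded. As `δ → 0` the fields converge boundedly to the principal value field of
`ρ`, by Hölder continuity with `α > 1 - 2 s`, and this field is almost everywhere the derivative of
the Riesz potential (`ae_deriv_rieszPotential`).
For the entropy (`entropy_tangent_le`) one uses `log T' ≤ T' - 1` and
`∫ T' ρ dx ≤ -∫ T ρ' dx` (`integral_deriv_monotoneMap_le`). The last inequality holds because the
pointwise derivative is only the absolutely continuous part of the measure `dT`. It presupposes
finite Fisher information, which follows from finite dissipation since the field and the second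
moment are finite.
The sum of the three tangent inequalities pairs the displacement `T - id` with the integrand of the
dissipation, and the Cauchy–Schwarz inequality gives the HWI inequality (`hwi_of_integrable`). If
the dissipation is infinite, the HWI inequality is nontrivial only at distance zero, where the two
measures coincide.

*Logarithmic Sobolev.* This is Young's inequality applied to the HWI inequality.

*Talagrand.* The energy is `λ`-convex along the displacement interpolation `(1 - t) T + t id`
(`energyValue_interp_le`). Comparing the minimiser at `t = 0` with the interpolated measures and
letting `t → 0` gives the inequality (`talagrand_of_isRegMinimizer`). No regularity of `ρ` beyond
boundedness is needed here.
-/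

namespace FracPressure

open ProbabilityTheory Filter Set
open scoped Topology

/-! ### Quantile functions and the monotone transport map -/

/-- The quantile function `u ↦ inf {x | u ≤ F(x)}` of a probability measure on the line with
distribution function `F`, set to `0` outside `(0, 1)`. -/
noncomputable def quantile (μ : Measure ℝ) (u : ℝ) : ℝ :=
  if u ∈ Ioo (0 : ℝ) 1 then sInf {x | u ≤ cdf μ x} else 0

/-- The monotone rearrangement `T = F_ν⁻¹ ∘ F_μ` of `μ` onto `ν`. It is meaningful where
`0 < F_μ < 1`, which is `μ`-almost everywhere if `μ` has no atoms. -/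
noncomputable def monotoneMap (μ ν : Measure ℝ) (x : ℝ) : ℝ := quantile ν (cdf μ x)

/-- The interval where `0 < F_μ < 1`. -/
def cdfSupport (μ : Measure ℝ) : Set ℝ := {x | cdf μ x ∈ Ioo (0 : ℝ) 1}

/-- The Galois connection between the quantile function and the distribution function. -/
lemma quantile_le_iff {μ : Measure ℝ} {u x : ℝ} (hu : u ∈ Ioo (0 : ℝ) 1) :
    quantile μ u ≤ x ↔ u ≤ cdf μ x := by
  have hbdd : BddBelow {x | u ≤ cdf μ x} := by
    obtain ⟨a, ha⟩ := ((tendsto_cdf_atBot μ).eventually (gt_mem_nhds hu.1)).exists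
    refine ⟨a, fun y hy => ?_⟩
    by_contra! h
    exact absurd (hy.trans (monotone_cdf μ h.le)) (not_le.2 ha)
  have hne : {x | u ≤ cdf μ x}.Nonempty := by
    obtain ⟨a, ha⟩ := ((tendsto_cdf_atTop μ).eventually (lt_mem_nhds hu.2)).exists
    exact ⟨a, ha.le⟩
  rw [quantile, if_pos hu]
  refine ⟨fun h => ?_, fun h => csInf_le hbdd h⟩
  have hlim : Tendsto (cdf μ) (𝓝[>] x) (𝓝 (cdf μ x)) :=
    ((cdf μ).right_continuous x).mono_left (nhdsWithin_mono _ Ioi_subset_Ici_self)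
  refine ge_of_tendsto hlim ?_
  filter_upwards [self_mem_nhdsWithin] with y hy
  obtain ⟨z, hz, hzy⟩ := exists_lt_of_csInf_lt hne (lt_of_le_of_lt h hy)
  exact le_trans hz (monotone_cdf μ hzy.le)

lemma monotoneOn_quantile (μ : Measure ℝ) : MonotoneOn (quantile μ) (Ioo 0 1) := by
  intro u hu v hv huv
  rw [quantile_le_iff hu]
  exact huv.trans ((quantile_le_iff hv).1 le_rfl)

lemma measurable_quantile (μ : Measure ℝ) : Measurable (quantile μ) := by
  refine measurable_of_Iic fun x => ?_
  have : quantile μ ⁻¹' Iic x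
      = (Ioo 0 1 ∩ Iic (cdf μ x)) ∪ ((Ioo (0 : ℝ) 1)ᶜ ∩ {_u | 0 ≤ x}) := by
    ext u
    by_cases hu : u ∈ Ioo (0 : ℝ) 1
    · simp only [mem_preimage, mem_Iic, quantile_le_iff hu, mem_union, mem_inter_iff, hu, true_and,
        mem_compl_iff, not_true, false_and, or_false]
    · simp only [mem_preimage, mem_Iic, quantile, if_false, mem_union, mem_inter_iff, hu,
        false_and, mem_compl_iff, not_false_iff, true_and, false_or, mem_ofPred_eq]
  rw [this]
  exact (measurableSet_Ioo.inter measurableSet_Iic).union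
    (measurableSet_Ioo.compl.inter (MeasurableSet.const _))

lemma measurable_cdf (μ : Measure ℝ) : Measurable (cdf μ) := (monotone_cdf μ).measurable

lemma measurable_monotoneMap (μ ν : Measure ℝ) : Measurable (monotoneMap μ ν) :=
  (measurable_quantile ν).comp (measurable_cdf μ)

/-- The quantile function pushes the uniform distribution on `(0, 1)` forward to `μ`. -/
lemma map_quantile (μ : Measure ℝ) [IsProbabilityMeasure μ] :
    (volume.restrict (Ioo (0 : ℝ) 1)).map (quantile μ) = μ := by
  have : IsFiniteMeasure ((volume.restrict (Ioo (0 : ℝ) 1)).map (quantile μ)) :=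
    Measure.isFiniteMeasure_map _ _
  refine Measure.ext_of_Iic _ _ fun x => ?_
  rw [Measure.map_apply (measurable_quantile μ) measurableSet_Iic,
    Measure.restrict_apply (measurable_quantile μ measurableSet_Iic)]
  have h1 : Ioo 0 (cdf μ x) ⊆ quantile μ ⁻¹' Iic x ∩ Ioo 0 1 := fun u hu => by
    have hu' : u ∈ Ioo (0 : ℝ) 1 := ⟨hu.1, hu.2.trans_le (cdf_le_one μ x)⟩
    exact ⟨(quantile_le_iff hu').2 hu.2.le, hu'⟩
  have h2 : quantile μ ⁻¹' Iic x ∩ Ioo 0 1 ⊆ Ioc 0 (cdf μ x) := fun u hu =>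
    ⟨hu.2.1, (quantile_le_iff hu.2).1 hu.1⟩
  rw [← ofReal_cdf μ x]
  apply le_antisymm
  · refine (measure_mono h2).trans ?_
    rw [Real.volume_Ioc, sub_zero]
  · refine le_trans ?_ (measure_mono h1)
    rw [Real.volume_Ioo, sub_zero]

lemma continuous_cdf (μ : Measure ℝ) [IsProbabilityMeasure μ] [NullSingletonClass μ] :
    Continuous (cdf μ) := by
  rw [continuous_iff_continuousAt]
  intro x
  rw [(monotone_cdf μ).continuousAt_iff_leftLim_eq_rightLim]
  have h : (cdf μ).measure {x} = 0 := by rw [measure_cdf]; exact measure_singleton x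
  rw [StieltjesFunction.measure_singleton, ENNReal.ofReal_eq_zero] at h
  have h2 := (monotone_cdf μ).leftLim_le (le_refl x)
  rw [StieltjesFunction.rightLim_eq]
  linarith

lemma cdf_quantile {μ : Measure ℝ} [IsProbabilityMeasure μ] [NullSingletonClass μ] {u : ℝ}
    (hu : u ∈ Ioo (0 : ℝ) 1) : cdf μ (quantile μ u) = u := by
  apply le_antisymm
  · have hlim : Tendsto (cdf μ) (𝓝[<] quantile μ u) (𝓝 (cdf μ (quantile μ u))) :=
      ((continuous_cdf μ).tendsto _).mono_left nhdsWithin_le_nhds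
    refine le_of_tendsto hlim ?_
    filter_upwards [self_mem_nhdsWithin] with y hy
    by_contra! h
    exact absurd ((quantile_le_iff hu).2 h.le) (not_le.2 hy)
  · exact (quantile_le_iff hu).1 le_rfl

lemma quantile_mem_cdfSupport {μ : Measure ℝ} [IsProbabilityMeasure μ] [NullSingletonClass μ]
    {u : ℝ} (hu : u ∈ Ioo (0 : ℝ) 1) : quantile μ u ∈ cdfSupport μ := by
  simpa only [cdfSupport, mem_ofPred_eq, cdf_quantile hu] using hu

/-- A property of the points `quantile μ u`, `0 < u < 1`, holds `μ`-almost everywhere. -/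
lemma ae_of_forall_quantile {μ : Measure ℝ} [IsProbabilityMeasure μ] {p : ℝ → Prop}
    (hp : MeasurableSet {x | p x}) (h : ∀ u ∈ Ioo (0 : ℝ) 1, p (quantile μ u)) :
    ∀ᵐ x ∂μ, p x := by
  rw [← map_quantile μ, ae_map_iff (measurable_quantile μ).aemeasurable hp]
  exact (ae_restrict_iff' measurableSet_Ioo).2 (Eventually.of_forall h)

lemma measurableSet_cdfSupport (μ : Measure ℝ) : MeasurableSet (cdfSupport μ) :=
  measurable_cdf μ measurableSet_Ioo

lemma isOpen_cdfSupport (μ : Measure ℝ) [IsProbabilityMeasure μ] [NullSingletonClass μ] :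
    IsOpen (cdfSupport μ) :=
  isOpen_Ioo.preimage (continuous_cdf μ)

lemma ordConnected_cdfSupport (μ : Measure ℝ) : OrdConnected (cdfSupport μ) :=
  ⟨fun _ hx _ hy _ hz =>
    ⟨hx.1.trans_le (monotone_cdf μ hz.1), (monotone_cdf μ hz.2).trans_lt hy.2⟩⟩

lemma ae_mem_cdfSupport (μ : Measure ℝ) [IsProbabilityMeasure μ] [NullSingletonClass μ] :
    ∀ᵐ x ∂μ, x ∈ cdfSupport μ :=
  ae_of_forall_quantile (measurableSet_cdfSupport μ) fun _ hu => quantile_mem_cdfSupport hu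

lemma monotoneOn_monotoneMap (μ ν : Measure ℝ) :
    MonotoneOn (monotoneMap μ ν) (cdfSupport μ) :=
  fun _ hx _ hy hxy => monotoneOn_quantile ν hx hy (monotone_cdf μ hxy)

lemma cdf_monotoneMap {μ ν : Measure ℝ} [IsProbabilityMeasure ν] [NullSingletonClass ν] {x : ℝ}
    (hx : x ∈ cdfSupport μ) : cdf ν (monotoneMap μ ν x) = cdf μ x :=
  cdf_quantile hx

lemma monotoneMap_quantile {μ ν : Measure ℝ} [IsProbabilityMeasure μ] [NullSingletonClass μ]
    {u : ℝ} (hu : u ∈ Ioo (0 : ℝ) 1) : monotoneMap μ ν (quantile μ u) = quantile ν u := by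
  rw [monotoneMap, cdf_quantile hu]

lemma map_monotoneMap (μ ν : Measure ℝ) [IsProbabilityMeasure μ] [IsProbabilityMeasure ν]
    [NullSingletonClass μ] : μ.map (monotoneMap μ ν) = ν := by
  calc μ.map (monotoneMap μ ν)
      = ((volume.restrict (Ioo (0 : ℝ) 1)).map (quantile μ)).map (monotoneMap μ ν) := by
        rw [map_quantile μ]
    _ = (volume.restrict (Ioo (0 : ℝ) 1)).map (monotoneMap μ ν ∘ quantile μ) :=
        Measure.map_map (measurable_monotoneMap _ _) (measurable_quantile _)
    _ = (volume.restrict (Ioo (0 : ℝ) 1)).map (quantile ν) :=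
        Measure.map_congr ((ae_restrict_iff' measurableSet_Ioo).2
          (Eventually.of_forall fun _ hu => monotoneMap_quantile hu))
    _ = ν := map_quantile ν

/-- The monotone map of `ν` onto `μ` inverts the one of `μ` onto `ν`. -/
lemma ae_monotoneMap_monotoneMap (μ ν : Measure ℝ) [IsProbabilityMeasure μ]
    [IsProbabilityMeasure ν] [NullSingletonClass μ] [NullSingletonClass ν] :
    ∀ᵐ x ∂μ, monotoneMap ν μ (monotoneMap μ ν x) = x := by
  refine ae_of_forall_quantile (measurableSet_eq_fun
    ((measurable_monotoneMap _ _).comp (measurable_monotoneMap _ _)) measurable_id) fun u hu => ?_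
  rw [monotoneMap_quantile hu, monotoneMap_quantile hu]

/-! ### Optimality of the monotone map -/

lemma integrable_mul_of_integrable_sq {Ω : Type*} [MeasurableSpace Ω] {μ : Measure Ω}
    {f g : Ω → ℝ} (hf : AEStronglyMeasurable f μ) (hg : AEStronglyMeasurable g μ)
    (hf2 : Integrable (fun x => f x ^ 2) μ) (hg2 : Integrable (fun x => g x ^ 2) μ) :
    Integrable (fun x => f x * g x) μ :=
  ((memLp_two_iff_integrable_sq hf).2 hf2).integrable_mul ((memLp_two_iff_integrable_sq hg).2 hg2)

lemma integral_sub_add {Ω : Type*} [MeasurableSpace Ω] {μ : Measure Ω} {f g h : Ω → ℝ}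
    (hf : Integrable f μ) (hg : Integrable g μ) (hh : Integrable h μ) :
    ∫ x, (f x - g x + h x) ∂μ = ∫ x, f x ∂μ - ∫ x, g x ∂μ + ∫ x, h x ∂μ := by
  have hfg : Integrable (fun x => f x - g x) μ := hf.sub hg
  rw [integral_add hfg hh, integral_sub hf hg]

lemma ae_comp_of_map_eq {Ω Ω' : Type*} [MeasurableSpace Ω] [MeasurableSpace Ω'] {γ : Measure Ω}
    {μ : Measure Ω'} {f : Ω → Ω'} (hf : Measurable f) (h : γ.map f = μ) {p : Ω' → Prop}
    (hp : ∀ᵐ x ∂μ, p x) : ∀ᵐ z ∂γ, p (f z) := by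
  subst h
  exact ae_of_ae_map hf.aemeasurable hp

lemma integrable_comp_of_map_eq {Ω Ω' : Type*} [MeasurableSpace Ω] [MeasurableSpace Ω']
    {γ : Measure Ω} {μ : Measure Ω'} {f : Ω → Ω'} (hf : Measurable f) (h : γ.map f = μ)
    {g : Ω' → ℝ} (hg : Integrable g μ) : Integrable (fun z => g (f z)) γ := by
  subst h
  exact (integrable_map_measure hg.1 hf.aemeasurable).1 hg

lemma integral_comp_of_map_eq {Ω Ω' : Type*} [MeasurableSpace Ω] [MeasurableSpace Ω']
    {γ : Measure Ω} {μ : Measure Ω'} {f : Ω → Ω'} (hf : Measurable f) (h : γ.map f = μ)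
    {g : Ω' → ℝ} (hg : AEStronglyMeasurable g μ) : ∫ z, g (f z) ∂γ = ∫ x, g x ∂μ := by
  subst h
  exact (integral_map hf.aemeasurable hg).symm

lemma integrable_of_integrable_sq {Ω : Type*} [MeasurableSpace Ω] {μ : Measure Ω}
    [IsFiniteMeasure μ] {f : Ω → ℝ} (hf : AEStronglyMeasurable f μ)
    (hf2 : Integrable (fun x => f x ^ 2) μ) : Integrable f μ := by
  simpa using integrable_mul_of_integrable_sq (g := fun _ => (1 : ℝ)) hf
    aestronglyMeasurable_const hf2 (integrable_const _)

lemma intervalIntegrable_monotoneMap {μ ν : Measure ℝ} {x y : ℝ} (hx : x ∈ cdfSupport μ)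
    (hy : y ∈ cdfSupport μ) :
    IntervalIntegrable (monotoneMap μ ν) volume x y :=
  ((monotoneOn_monotoneMap μ ν).mono
    ((ordConnected_cdfSupport μ).uIcc_subset hx hy)).intervalIntegrable

/-- A primitive of the monotone map lies above its tangents. -/
lemma monotoneMap_mul_sub_le {μ ν : Measure ℝ} {x z : ℝ} (hx : x ∈ cdfSupport μ)
    (hz : z ∈ cdfSupport μ) :
    monotoneMap μ ν z * (x - z) ≤ ∫ t in z..x, monotoneMap μ ν t := by
  have hsub := (ordConnected_cdfSupport μ).uIcc_subset hz hx
  have hi := intervalIntegrable_monotoneMap (ν := ν) hz hx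
  rcases le_total z x with h | h
  · have := intervalIntegral.integral_mono_on (μ := volume) (a := z) (b := x)
      (f := fun _ => monotoneMap μ ν z) h intervalIntegrable_const hi fun t ht =>
        monotoneOn_monotoneMap μ ν hz (hsub (Icc_subset_uIcc ht)) ht.1
    rwa [intervalIntegral.integral_const, smul_eq_mul, mul_comm] at this
  · have := intervalIntegral.integral_mono_on (μ := volume) (a := x) (b := z)
      (g := fun _ => monotoneMap μ ν z) h hi.symm intervalIntegrable_const fun t ht =>
        monotoneOn_monotoneMap μ ν (hsub (Icc_subset_uIcc' ht)) hz ht.2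
    rw [intervalIntegral.integral_const, smul_eq_mul] at this
    rw [intervalIntegral.integral_symm]
    linarith

section

variable {μ ν : Measure ℝ} [IsProbabilityMeasure μ] [IsProbabilityMeasure ν]
  [NullSingletonClass μ]

lemma integrable_monotoneMap_sq (hν : Integrable (fun x : ℝ => x ^ 2) ν) :
    Integrable (fun x => monotoneMap μ ν x ^ 2) μ :=
  integrable_comp_of_map_eq (measurable_monotoneMap _ _) (map_monotoneMap μ ν) hν

lemma integrable_monotoneMap_sub_sq (hμ : Integrable (fun x : ℝ => x ^ 2) μ)
    (hν : Integrable (fun x : ℝ => x ^ 2) ν) :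
    Integrable (fun x => (monotoneMap μ ν x - x) ^ 2) μ := by
  have h1 := integrable_monotoneMap_sq (μ := μ) hν
  have h2 := integrable_mul_of_integrable_sq (g := fun x : ℝ => x)
    (measurable_monotoneMap μ ν).aestronglyMeasurable (by fun_prop) h1 hμ
  refine ((h1.sub (h2.const_mul 2)).add hμ).congr (Eventually.of_forall fun x => ?_)
  simp only [Pi.add_apply, Pi.sub_apply]
  ring

/-- Among all couplings of `μ` and `ν`, the one induced by the monotone map has the largest
correlation. With `φ` a primitive of `T = monotoneMap μ ν` and `R = monotoneMap ν μ`, integrate the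
tangent inequality `φ(x) ≥ φ(R(y)) + y (x - R(y))`. -/
lemma integral_mul_le_of_mem_couplings [NullSingletonClass ν]
    (hμ : Integrable (fun x : ℝ => x ^ 2) μ)
    (hν : Integrable (fun x : ℝ => x ^ 2) ν) {γ : Measure (ℝ × ℝ)} (hγ : γ ∈ couplings μ ν) :
    Integrable (fun p : ℝ × ℝ => p.1 * p.2) γ ∧
      ∫ p, p.1 * p.2 ∂γ ≤ ∫ x, monotoneMap μ ν x * x ∂μ := by
  obtain ⟨h1, h2⟩ := hγ
  have intf : ∀ {f : ℝ → ℝ}, Integrable f μ → Integrable (fun p : ℝ × ℝ => f p.1) γ :=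
    fun hf => integrable_comp_of_map_eq measurable_fst h1 hf
  have ints : ∀ {f : ℝ → ℝ}, Integrable f ν → Integrable (fun p : ℝ × ℝ => f p.2) γ :=
    fun hf => integrable_comp_of_map_eq measurable_snd h2 hf
  have hxy : Integrable (fun p : ℝ × ℝ => p.1 * p.2) γ :=
    integrable_mul_of_integrable_sq (by fun_prop) (by fun_prop)
      (intf hμ) (ints hν)
  refine ⟨hxy, ?_⟩
  obtain ⟨m, hm⟩ := (ae_mem_cdfSupport μ).exists
  set T := monotoneMap μ ν with hT
  set R := monotoneMap ν μ with hR
  set φ : ℝ → ℝ := fun x => ∫ t in m..x, T t with hφ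
  have htan : ∀ x ∈ cdfSupport μ, ∀ z ∈ cdfSupport μ, φ z + T z * (x - z) ≤ φ x := by
    intro x hx z hz
    have e : φ x = φ z + ∫ t in z..x, T t :=
      (intervalIntegral.integral_add_adjacent_intervals
        (intervalIntegrable_monotoneMap hm hz) (intervalIntegrable_monotoneMap hz hx)).symm
    rw [e]
    linarith [monotoneMap_mul_sub_le (ν := ν) hx hz]
  have hconv : ConvexOn ℝ (cdfSupport μ) φ := by
    refine ⟨(ordConnected_cdfSupport μ).convex, fun x hx y hy a b ha hb hab => ?_⟩
    have hz := (ordConnected_cdfSupport μ).convex hx hy ha hb hab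
    simp only [smul_eq_mul] at hz ⊢
    have e1 := mul_le_mul_of_nonneg_left (htan x hx _ hz) ha
    have e2 := mul_le_mul_of_nonneg_left (htan y hy _ hz) hb
    have e3 : a * (T (a * x + b * y) * (x - (a * x + b * y)))
        + b * (T (a * x + b * y) * (y - (a * x + b * y)))
        = T (a * x + b * y) * ((a * x + b * y) * (1 - (a + b))) := by ring
    rw [hab, sub_self, mul_zero, mul_zero] at e3
    have e4 : φ (a * x + b * y) = a * φ (a * x + b * y) + b * φ (a * x + b * y) := by
      rw [← add_mul, hab, one_mul]
    rw [mul_add] at e1 e2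
    linarith
  have hφm : AEStronglyMeasurable φ μ := by
    have := (hconv.continuousOn (isOpen_cdfSupport μ)).aestronglyMeasurable (μ := μ)
      (measurableSet_cdfSupport μ)
    rwa [Measure.restrict_eq_self_of_ae_mem (ae_mem_cdfSupport μ)] at this
  have hx1 : Integrable (fun x : ℝ => x) μ := integrable_of_integrable_sq (by fun_prop) hμ
  have hTm : AEStronglyMeasurable T μ := (measurable_monotoneMap μ ν).aestronglyMeasurable
  have hTi : Integrable T μ := integrable_of_integrable_sq hTm (integrable_monotoneMap_sq hν)
  have hTx : Integrable (fun x => T x * x) μ :=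
    integrable_mul_of_integrable_sq hTm (by fun_prop) (integrable_monotoneMap_sq hν) hμ
  have hφi : Integrable φ μ := by
    refine Integrable.mono' (((hx1.sub (integrable_const m)).const_mul (T m)).abs.add
      (hTx.sub (hTi.mul_const m)).abs) hφm ?_
    filter_upwards [ae_mem_cdfSupport μ] with x hx
    have b1 := htan x hx m hm
    have b2 := htan m hm x hx
    have b0 : φ m = 0 := intervalIntegral.integral_same
    simp only [Pi.add_apply, Pi.sub_apply, Real.norm_eq_abs]
    have c1 := abs_le.1 (le_refl |T m * (x - m)|)
    have c2 := abs_le.1 (le_refl |T x * x - T x * m|)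
    rw [abs_le]
    constructor <;> nlinarith
  have hRν : ν.map R = μ := map_monotoneMap ν μ
  have hRm : Measurable R := measurable_monotoneMap ν μ
  have hφR : Integrable (fun y => φ (R y)) ν := integrable_comp_of_map_eq hRm hRν hφi
  have eφR : ∫ y, φ (R y) ∂ν = ∫ x, φ x ∂μ := integral_comp_of_map_eq hRm hRν hφm
  have hyR : Integrable (fun y => y * R y) ν :=
    integrable_mul_of_integrable_sq (by fun_prop) hRm.aestronglyMeasurable hν
      (integrable_monotoneMap_sq hμ)
  have eyR : ∫ y, y * R y ∂ν = ∫ x, T x * x ∂μ := by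
    rw [← integral_comp_of_map_eq (measurable_monotoneMap μ ν) (map_monotoneMap μ ν) hyR.1]
    refine integral_congr_ae ?_
    filter_upwards [ae_monotoneMap_monotoneMap μ ν] with x hx
    rw [hR, hx]
  have aef : ∀ᵐ p ∂γ, p.1 ∈ cdfSupport μ :=
    ae_comp_of_map_eq measurable_fst h1 (ae_mem_cdfSupport μ)
  have aes : ∀ᵐ p ∂γ, R p.2 ∈ cdfSupport μ ∧ T (R p.2) = p.2 :=
    ae_comp_of_map_eq measurable_snd h2
      ((ae_comp_of_map_eq hRm hRν (ae_mem_cdfSupport μ)).and (ae_monotoneMap_monotoneMap ν μ))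
  have key : ∫ p, p.1 * p.2 ∂γ ≤ ∫ p, (φ p.1 - φ (R p.2) + p.2 * R p.2) ∂γ := by
    refine integral_mono_ae hxy (((intf hφi).sub (ints hφR)).add (ints hyR)) ?_
    filter_upwards [aef, aes] with p hp hq
    have := htan p.1 hp (R p.2) hq.1
    rw [hq.2] at this
    linarith
  rw [integral_sub_add (intf hφi) (ints hφR) (ints hyR),
    integral_comp_of_map_eq measurable_fst h1 hφi.1,
    integral_comp_of_map_eq (g := fun y => φ (R y)) measurable_snd h2 hφR.1,
    integral_comp_of_map_eq (g := fun y => y * R y) measurable_snd h2 hyR.1,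
    eφR, eyR, sub_self, zero_add] at key
  exact key

/-- On the line the quadratic Wasserstein distance is realised by the monotone map. -/
lemma W2_eq_ofReal_sqrt [NullSingletonClass ν] (hμ : Integrable (fun x : ℝ => x ^ 2) μ)
    (hν : Integrable (fun x : ℝ => x ^ 2) ν) :
    W2 μ ν = ENNReal.ofReal (Real.sqrt (∫ x, (monotoneMap μ ν x - x) ^ 2 ∂μ)) := by
  set T := monotoneMap μ ν with hT
  have hTm : Measurable T := measurable_monotoneMap μ ν
  have hTs := integrable_monotoneMap_sq (μ := μ) hν
  have hTx : Integrable (fun x => T x * x) μ :=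
    integrable_mul_of_integrable_sq hTm.aestronglyMeasurable (by fun_prop) hTs hμ
  have hD := integrable_monotoneMap_sub_sq (μ := μ) hμ hν
  have hD0 : 0 ≤ ∫ x, (T x - x) ^ 2 ∂μ := integral_nonneg fun x => sq_nonneg _
  have eD : ∫ x, (T x - x) ^ 2 ∂μ
      = ∫ x, T x ^ 2 ∂μ - 2 * ∫ x, T x * x ∂μ + ∫ x, x ^ 2 ∂μ := by
    rw [← integral_const_mul, ← integral_sub_add hTs (hTx.const_mul 2) hμ]
    exact integral_congr_ae (Eventually.of_forall fun x => by ring)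
  have eT : ∫ x, T x ^ 2 ∂μ = ∫ y, y ^ 2 ∂ν :=
    integral_comp_of_map_eq hTm (map_monotoneMap μ ν) hν.1
  have main : ⨅ γ ∈ couplings μ ν, ∫⁻ p : ℝ × ℝ, ENNReal.ofReal (|p.1 - p.2| ^ 2) ∂γ
      = ENNReal.ofReal (∫ x, (T x - x) ^ 2 ∂μ) := by
    apply le_antisymm
    · have hmem : μ.map (fun x => (x, T x)) ∈ couplings μ ν := by
        constructor
        · rw [Measure.map_map measurable_fst (by fun_prop)]
          exact Measure.map_id
        · rw [Measure.map_map measurable_snd (by fun_prop)]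
          exact map_monotoneMap μ ν
      refine (iInf₂_le _ hmem).trans ?_
      rw [lintegral_map (by fun_prop) (by fun_prop),
        ofReal_integral_eq_lintegral_ofReal hD (Eventually.of_forall fun x => sq_nonneg _)]
      refine lintegral_mono fun x => ?_
      rw [sq_abs, ← neg_sub, neg_sq]
    · refine le_iInf₂ fun γ hγ => ?_
      obtain ⟨i12, hle⟩ := integral_mul_le_of_mem_couplings hμ hν hγ
      obtain ⟨h1, h2⟩ := hγ
      have i1 := integrable_comp_of_map_eq measurable_fst h1 hμ
      have i2 := integrable_comp_of_map_eq measurable_snd h2 hν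
      have e1 := integral_comp_of_map_eq measurable_fst h1 hμ.1
      have e2 := integral_comp_of_map_eq measurable_snd h2 hν.1
      have iD : Integrable (fun p : ℝ × ℝ => |p.1 - p.2| ^ 2) γ := by
        refine ((i1.sub (i12.const_mul 2)).add i2).congr (Eventually.of_forall fun x => ?_)
        simp only [Pi.add_apply, Pi.sub_apply, sq_abs]
        ring
      rw [← ofReal_integral_eq_lintegral_ofReal iD (Eventually.of_forall fun x => sq_nonneg _)]
      refine ENNReal.ofReal_le_ofReal ?_
      have e3 : ∫ p : ℝ × ℝ, |p.1 - p.2| ^ 2 ∂γ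
          = ∫ p : ℝ × ℝ, p.1 ^ 2 ∂γ - 2 * ∫ p : ℝ × ℝ, p.1 * p.2 ∂γ + ∫ p : ℝ × ℝ, p.2 ^ 2 ∂γ := by
        rw [← integral_const_mul, ← integral_sub_add i1 (i12.const_mul 2) i2]
        exact integral_congr_ae (Eventually.of_forall fun x => by simp only [sq_abs]; ring)
      rw [eD, eT, e3, e1, e2]
      linarith
  rw [W2, main, ENNReal.ofReal_rpow_of_nonneg hD0 (by norm_num), Real.sqrt_eq_rpow]

end

/-! ### The Riesz kernel on the half-line -/

/-- The constant `k > 0` such that the kernel `W` satisfies `W'(z) = -k z ^ (2 s - 2)` for `z > 0`,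
for all `s ∈ (0, 1]` alike, `s = 1 / 2` included. -/
noncomputable def rieszSlope (s : ℝ) : ℝ :=
  2 * s * (2 : ℝ) ^ (-2 * s) * Real.Gamma (3 / 2 - s) / (Real.sqrt Real.pi * Real.Gamma (1 + s))

lemma rieszSlope_pos {s : ℝ} (hs0 : 0 < s) (hs1 : s ≤ 1) : 0 < rieszSlope s := by
  have h1 : 0 < Real.Gamma (3 / 2 - s) := Real.Gamma_pos_of_pos (by linarith)
  have h2 : 0 < Real.Gamma (1 + s) := Real.Gamma_pos_of_pos (by linarith)
  have h3 := Real.pi_pos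
  unfold rieszSlope
  positivity

lemma rieszSlope_one_half : rieszSlope (1 / 2) = 1 / Real.pi := by
  have e1 : (3 / 2 - 1 / 2 : ℝ) = 1 := by norm_num
  have e2 : (1 + 1 / 2 : ℝ) = 1 / 2 + 1 := by norm_num
  have e3 : (-2 * (1 / 2) : ℝ) = -1 := by norm_num
  have e4 : Real.sqrt Real.pi * (1 / 2 * Real.sqrt Real.pi) = Real.pi / 2 := by
    have := Real.mul_self_sqrt Real.pi_pos.le
    linarith
  rw [rieszSlope, e1, e2, e3, Real.Gamma_one, Real.Gamma_add_one (by norm_num),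
    Real.Gamma_one_half_eq, Real.rpow_neg_one, e4]
  have := Real.pi_pos.ne'
  field_simp

lemma rieszConst_mul {s : ℝ} (hs : s ≠ 1 / 2) :
    rieszConst s * (2 * s - 1) = -rieszSlope s := by
  have h : (1 / 2 - s : ℝ) ≠ 0 := fun h => hs (by linarith)
  have e : (3 / 2 - s : ℝ) = (1 / 2 - s) + 1 := by ring
  rw [rieszConst, rieszSlope, e, Real.Gamma_add_one h]
  ring

lemma rieszKernel_neg (s x : ℝ) : rieszKernel s (-x) = rieszKernel s x := by
  rw [rieszKernel, rieszKernel, abs_neg]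

lemma rieszKernel_abs (s x : ℝ) : rieszKernel s |x| = rieszKernel s x := by
  rw [rieszKernel, rieszKernel, abs_abs]

lemma measurable_rieszKernel (s : ℝ) : Measurable (rieszKernel s) := by
  unfold rieszKernel
  split_ifs
  · exact (Real.measurable_log.comp measurable_norm).const_mul _
  · exact (measurable_norm.pow_const _).const_mul _

lemma hasDerivAt_rieszKernel {s : ℝ} {z : ℝ} (hz : 0 < z) :
    HasDerivAt (rieszKernel s) (-(rieszSlope s * z ^ (2 * s - 2))) z := by
  by_cases hs : s = 1 / 2
  · have e : rieszKernel s =ᶠ[𝓝 z] fun x => -(1 / Real.pi) * Real.log x := by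
      filter_upwards [lt_mem_nhds hz] with x hx
      rw [rieszKernel, if_pos hs, abs_of_pos hx]
    refine (HasDerivAt.congr_of_eventuallyEq ?_ e)
    refine ((Real.hasDerivAt_log hz.ne').const_mul (-(1 / Real.pi))).congr_deriv ?_
    rw [hs, rieszSlope_one_half, show (2 * (1 / 2) - 2 : ℝ) = -1 by norm_num, Real.rpow_neg_one]
    ring
  · have e : rieszKernel s =ᶠ[𝓝 z] fun x => rieszConst s * x ^ (2 * s - 1) := by
      filter_upwards [lt_mem_nhds hz] with x hx
      rw [rieszKernel, if_neg hs, abs_of_pos hx]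
    refine (HasDerivAt.congr_of_eventuallyEq ?_ e)
    refine ((Real.hasDerivAt_rpow_const (p := 2 * s - 1) (Or.inl hz.ne')).const_mul
      (rieszConst s)).congr_deriv ?_
    rw [← mul_assoc, rieszConst_mul hs, show (2 * s - 1 - 1 : ℝ) = 2 * s - 2 by ring]
    ring

lemma continuousOn_rieszKernel (s : ℝ) : ContinuousOn (rieszKernel s) (Ioi 0) :=
  fun _ hz => (hasDerivAt_rieszKernel hz).continuousAt.continuousWithinAt

lemma antitoneOn_rieszKernel {s : ℝ} (hs0 : 0 < s) (hs1 : s ≤ 1) :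
    AntitoneOn (rieszKernel s) (Ioi 0) := by
  refine antitoneOn_of_deriv_nonpos (convex_Ioi 0) (continuousOn_rieszKernel s) ?_ ?_
  all_goals rw [interior_Ioi]
  · exact fun z hz => (hasDerivAt_rieszKernel hz).differentiableAt.differentiableWithinAt
  · intro z hz
    rw [(hasDerivAt_rieszKernel hz).deriv, neg_nonpos]
    exact mul_nonneg (rieszSlope_pos hs0 hs1).le (Real.rpow_nonneg (le_of_lt hz) _)

lemma convexOn_rieszKernel {s : ℝ} (hs0 : 0 < s) (hs1 : s ≤ 1) :
    ConvexOn ℝ (Ioi 0) (rieszKernel s) := by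
  refine MonotoneOn.convexOn_of_deriv (convex_Ioi 0) (continuousOn_rieszKernel s) ?_ ?_
  all_goals rw [interior_Ioi]
  · exact fun z hz => (hasDerivAt_rieszKernel hz).differentiableAt.differentiableWithinAt
  · intro a ha b hb hab
    rw [(hasDerivAt_rieszKernel ha).deriv, (hasDerivAt_rieszKernel hb).deriv, neg_le_neg_iff]
    exact mul_le_mul_of_nonneg_left (Real.rpow_le_rpow_of_nonpos ha hab (by linarith))
      (rieszSlope_pos hs0 hs1).le

/-- The kernel lies above its tangents on the positive half-line. -/
lemma rieszKernel_tangent_le {s : ℝ} (hs0 : 0 < s) (hs1 : s ≤ 1) {a b : ℝ} (ha : 0 < a)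
    (hb : 0 < b) :
    rieszKernel s a - rieszSlope s * a ^ (2 * s - 2) * (b - a) ≤ rieszKernel s b := by
  have hc := convexOn_rieszKernel hs0 hs1
  rcases lt_trichotomy a b with h | h | h
  · have := hc.le_slope_of_hasDerivAt ha hb h (hasDerivAt_rieszKernel ha)
    rw [slope_def_field, le_div_iff₀ (by linarith)] at this
    linarith
  · simp [h]
  · have := hc.slope_le_of_hasDerivAt hb ha h (hasDerivAt_rieszKernel ha)
    rw [slope_def_field, div_le_iff₀ (by linarith)] at this
    linarith

/-- A constant `C` such that `-C (1 + |z|) ≤ W(z)`, with `|W(z)| ≤ C (1 + |z|)` for `|z| ≥ 1`. -/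
noncomputable def rieszGrowth (s : ℝ) : ℝ := |rieszKernel s 1| + rieszSlope s

lemma rieszGrowth_nonneg {s : ℝ} (hs0 : 0 < s) (hs1 : s ≤ 1) : 0 ≤ rieszGrowth s :=
  add_nonneg (abs_nonneg _) (rieszSlope_pos hs0 hs1).le

lemma neg_rieszGrowth_le {s : ℝ} (hs0 : 0 < s) (hs1 : s ≤ 1) {z : ℝ} (hz : z ≠ 0) :
    -(rieszGrowth s * (1 + |z|)) ≤ rieszKernel s z := by
  have h := rieszKernel_tangent_le hs0 hs1 one_pos (abs_pos.2 hz)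
  rw [Real.one_rpow, rieszKernel_abs] at h
  have h1 := neg_abs_le (rieszKernel s 1)
  have h2 := rieszSlope_pos hs0 hs1
  have h3 := mul_nonneg (abs_nonneg (rieszKernel s 1)) (abs_nonneg z)
  unfold rieszGrowth
  nlinarith

lemma rieszKernel_le_one {s : ℝ} (hs0 : 0 < s) (hs1 : s ≤ 1) {z : ℝ} (hz : 1 ≤ |z|) :
    rieszKernel s z ≤ |rieszKernel s 1| := by
  rw [← rieszKernel_abs s z]
  exact (antitoneOn_rieszKernel hs0 hs1 (mem_Ioi.2 one_pos) (mem_Ioi.2 (one_pos.trans_le hz))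
    hz).trans (le_abs_self _)

/-- The singular part of the kernel, an integrable function. -/
noncomputable def rieszSingular (s : ℝ) : ℝ → ℝ :=
  indicator (Icc (-1) 1) fun z => |rieszKernel s z|

lemma abs_rieszKernel_le {s : ℝ} (hs0 : 0 < s) (hs1 : s ≤ 1) (z : ℝ) :
    |rieszKernel s z| ≤ rieszSingular s z + rieszGrowth s * (1 + |z|) := by
  have hC := rieszGrowth_nonneg hs0 hs1
  have hz := abs_nonneg z
  have hCz := mul_nonneg hC hz
  by_cases h : z ∈ Icc (-1 : ℝ) 1
  · rw [rieszSingular, indicator_of_mem h]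
    linarith
  · rw [rieszSingular, indicator_of_notMem h, zero_add, abs_le]
    have h1 : 1 < |z| := by
      by_contra! h'
      exact h (abs_le.1 h')
    have h2 := rieszKernel_le_one hs0 hs1 h1.le
    refine ⟨neg_rieszGrowth_le hs0 hs1 fun h0 => ?_, ?_⟩
    · rw [h0, abs_zero] at h1
      linarith
    · have := (rieszSlope_pos hs0 hs1).le
      have h3 : |rieszKernel s 1| ≤ rieszGrowth s := le_add_of_nonneg_right this
      linarith

lemma intervalIntegrable_rieszKernel {s : ℝ} (hs0 : 0 < s) :
    IntervalIntegrable (rieszKernel s) volume 0 1 := by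
  by_cases hs : s = 1 / 2
  · have : IntervalIntegrable (fun x => -(1 / Real.pi) * Real.log x) volume 0 1 :=
      intervalIntegral.intervalIntegrable_log'.const_mul _
    refine this.congr_ae ?_
    rw [uIoc_of_le zero_le_one]
    refine (ae_restrict_iff' measurableSet_Ioc).2 (Eventually.of_forall fun x hx => ?_)
    rw [rieszKernel, if_pos hs, abs_of_pos hx.1]
  · have : IntervalIntegrable (fun x => rieszConst s * x ^ (2 * s - 1)) volume 0 1 :=
      (intervalIntegral.intervalIntegrable_rpow' (by linarith)).const_mul _
    refine this.congr_ae ?_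
    rw [uIoc_of_le zero_le_one]
    refine (ae_restrict_iff' measurableSet_Ioc).2 (Eventually.of_forall fun x hx => ?_)
    rw [rieszKernel, if_neg hs, abs_of_pos hx.1]

lemma integrable_indicator_Icc_of_even {f : ℝ → ℝ} (hf : ∀ x, f (-x) = f x)
    (hi : IntervalIntegrable f volume 0 1) : Integrable (indicator (Icc (-1) 1) f) volume := by
  have h1 : IntervalIntegrable f volume (-1) 0 := by
    have := (IntervalIntegrable.iff_comp_neg (f := f) (a := 0) (b := 1)).1 hi
    simp only [hf, neg_zero] at this
    exact this.symm
  rw [integrable_indicator_iff measurableSet_Icc,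
    ← intervalIntegrable_iff_integrableOn_Icc_of_le (by norm_num)]
  exact h1.trans hi

lemma integrable_rieszSingular {s : ℝ} (hs0 : 0 < s) : Integrable (rieszSingular s) volume :=
  integrable_indicator_Icc_of_even (fun x => by rw [rieszKernel_neg])
    (intervalIntegrable_rieszKernel hs0).abs

/-! ### Shifted kernels -/

/-- The kernel `W(|z| + δ)`: convex and smooth on each closed half-line, and
below `W`, for `δ > 0`. -/
noncomputable def regKernel (s δ z : ℝ) : ℝ := rieszKernel s (|z| + δ)

/-- The derivative `sgn(z) W'(|z| + δ)` of the shifted kernel. For `δ = 0` this is the derivative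
of `W` itself. -/
noncomputable def regForce (s δ z : ℝ) : ℝ :=
  -(rieszSlope s * (|z| + δ) ^ (2 * s - 2)) * (z / |z|)

lemma abs_div_abs_self_le (z : ℝ) : abs (z / |z|) ≤ 1 := by
  rw [abs_div, abs_abs]
  exact div_self_le_one _

lemma measurable_regKernel (s δ : ℝ) : Measurable (regKernel s δ) :=
  (measurable_rieszKernel s).comp (by fun_prop)

lemma measurable_regForce (s δ : ℝ) : Measurable (regForce s δ) := by
  unfold regForce
  fun_prop

lemma regForce_neg (s δ z : ℝ) : regForce s δ (-z) = -regForce s δ z := by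
  unfold regForce
  rw [abs_neg]
  ring

section

variable {s : ℝ} (hs0 : 0 < s) (hs1 : s ≤ 1)

include hs0 hs1

lemma regKernel_le {δ z : ℝ} (hδ : 0 < δ) (hz : z ≠ 0) : regKernel s δ z ≤ rieszKernel s z := by
  rw [← rieszKernel_abs s z]
  have := abs_pos.2 hz
  exact antitoneOn_rieszKernel hs0 hs1 (mem_Ioi.2 this) (mem_Ioi.2 (by linarith)) (by linarith)

lemma neg_rieszGrowth_le_regKernel {δ : ℝ} (hδ : 0 < δ) (z : ℝ) :
    -(rieszGrowth s * (1 + |z| + δ)) ≤ regKernel s δ z := by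
  have h : 0 < |z| + δ := add_pos_of_nonneg_of_pos (abs_nonneg z) hδ
  have := neg_rieszGrowth_le hs0 hs1 h.ne'
  rwa [abs_of_pos h, ← add_assoc] at this

/-- A bound uniform in the shift. -/
lemma abs_regKernel_le_of_le_one {δ z : ℝ} (hδ : 0 < δ) (hδ1 : δ ≤ 1) (hz : z ≠ 0) :
    |regKernel s δ z| ≤ |rieszKernel s z| + rieszGrowth s * (2 + |z|) := by
  have h1 := regKernel_le hs0 hs1 hδ hz
  have h2 := neg_rieszGrowth_le_regKernel hs0 hs1 hδ z
  have hC := rieszGrowth_nonneg hs0 hs1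
  have hz0 := abs_nonneg z
  have h3 : rieszGrowth s * (1 + |z| + δ) ≤ rieszGrowth s * (2 + |z|) :=
    mul_le_mul_of_nonneg_left (by linarith) hC
  have h4 : 0 ≤ rieszGrowth s * (2 + |z|) := by positivity
  have h5 := abs_nonneg (rieszKernel s z)
  have h6 := le_abs_self (rieszKernel s z)
  rw [abs_le]
  constructor <;> linarith

/-- A bound without singularity, for a fixed shift. -/
lemma abs_regKernel_le {δ : ℝ} (hδ : 0 < δ) (z : ℝ) :
    |regKernel s δ z| ≤ |rieszKernel s δ| + rieszGrowth s * (1 + |z| + δ) := by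
  have h2 := neg_rieszGrowth_le_regKernel hs0 hs1 hδ z
  have hC := rieszGrowth_nonneg hs0 hs1
  have hz0 := abs_nonneg z
  have h1 : regKernel s δ z ≤ rieszKernel s δ :=
    antitoneOn_rieszKernel hs0 hs1 (mem_Ioi.2 hδ) (mem_Ioi.2 (by linarith)) (by linarith)
  have h4 : 0 ≤ rieszGrowth s * (1 + |z| + δ) := by positivity
  have h5 := abs_nonneg (rieszKernel s δ)
  have h6 := le_abs_self (rieszKernel s δ)
  rw [abs_le]
  constructor <;> linarith

lemma abs_regForce_le {δ : ℝ} (z : ℝ) (hδ : 0 ≤ δ) :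
    |regForce s δ z| ≤ rieszSlope s * (|z| + δ) ^ (2 * s - 2) := by
  have hk := (rieszSlope_pos hs0 hs1).le
  have h0 : 0 ≤ rieszSlope s * (|z| + δ) ^ (2 * s - 2) :=
    mul_nonneg hk (Real.rpow_nonneg (add_nonneg (abs_nonneg z) hδ) _)
  rw [regForce, abs_mul, abs_neg, abs_of_nonneg h0]
  exact mul_le_of_le_one_right h0 (abs_div_abs_self_le z)

lemma abs_regForce_le_const {δ : ℝ} (hδ : 0 < δ) (z : ℝ) :
    |regForce s δ z| ≤ rieszSlope s * δ ^ (2 * s - 2) :=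
  (abs_regForce_le hs0 hs1 z hδ.le).trans (mul_le_mul_of_nonneg_left
    (Real.rpow_le_rpow_of_nonpos hδ (by linarith [abs_nonneg z]) (by linarith))
    (rieszSlope_pos hs0 hs1).le)

lemma abs_regForce_le_rpow {δ z : ℝ} (hδ : 0 ≤ δ) (hz : z ≠ 0) :
    |regForce s δ z| ≤ rieszSlope s * |z| ^ (2 * s - 2) :=
  (abs_regForce_le hs0 hs1 z hδ).trans (mul_le_mul_of_nonneg_left
    (Real.rpow_le_rpow_of_nonpos (abs_pos.2 hz) (by linarith) (by linarith))
    (rieszSlope_pos hs0 hs1).le)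

/-- The shifted kernel lies above its tangents on each closed half-line. -/
lemma regKernel_tangent_le {δ a b : ℝ} (hδ : 0 < δ) (h0 : a = 0 → b = 0) (hab : 0 ≤ a * b) :
    regKernel s δ a + regForce s δ a * (b - a) ≤ regKernel s δ b := by
  have h := rieszKernel_tangent_le hs0 hs1 (a := |a| + δ) (b := |b| + δ)
    (by linarith [abs_nonneg a]) (by linarith [abs_nonneg b])
  have e : a / |a| * (b - a) = |b| - |a| := by
    rcases lt_trichotomy a 0 with ha | ha | ha
    · have hb : b ≤ 0 := by
        by_contra! hb
        exact absurd hab (not_le.2 (mul_neg_of_neg_of_pos ha hb))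
      rw [abs_of_neg ha, abs_of_nonpos hb, div_neg, div_self ha.ne]
      ring
    · simp [ha, h0 ha]
    · have hb : 0 ≤ b := by
        by_contra! hb
        exact absurd hab (not_le.2 (mul_neg_of_pos_of_neg ha hb))
      rw [abs_of_pos ha, abs_of_nonneg hb, div_self ha.ne']
      ring
  unfold regKernel regForce
  rw [mul_assoc, e]
  linarith

lemma lipschitz_regKernel {δ : ℝ} (hδ : 0 < δ) (a b : ℝ) :
    |regKernel s δ a - regKernel s δ b| ≤ rieszSlope s * δ ^ (2 * s - 2) * |a - b| := by
  have key : ∀ x y : ℝ,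
      regKernel s δ x - regKernel s δ y ≤ rieszSlope s * δ ^ (2 * s - 2) * |x - y| := by
    intro x y
    have hx := abs_nonneg x
    have h := rieszKernel_tangent_le hs0 hs1 (a := |x| + δ) (b := |y| + δ)
      (by linarith) (by linarith [abs_nonneg y])
    have hk := (rieszSlope_pos hs0 hs1).le
    have h1 : (|x| + δ) ^ (2 * s - 2) ≤ δ ^ (2 * s - 2) :=
      Real.rpow_le_rpow_of_nonpos hδ (by linarith) (by linarith)
    have h2 : |y| - |x| ≤ |x - y| := by
      rw [abs_sub_comm]
      exact abs_sub_abs_le_abs_sub y x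
    have h3 : 0 ≤ (|x| + δ) ^ (2 * s - 2) := Real.rpow_nonneg (by linarith) _
    calc regKernel s δ x - regKernel s δ y
        ≤ rieszSlope s * (|x| + δ) ^ (2 * s - 2) * (|y| - |x|) := by
          unfold regKernel
          linarith
      _ ≤ rieszSlope s * (|x| + δ) ^ (2 * s - 2) * |x - y| :=
          mul_le_mul_of_nonneg_left h2 (mul_nonneg hk h3)
      _ ≤ _ := mul_le_mul_of_nonneg_right (mul_le_mul_of_nonneg_left h1 hk) (abs_nonneg _)
  rw [abs_le]
  have h1 := key a b
  have h2 := key b a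
  rw [abs_sub_comm b a] at h2
  constructor <;> linarith

end

lemma hasDerivAt_regKernel {s δ z : ℝ} (hδ : 0 < δ) (hz : z ≠ 0) :
    HasDerivAt (regKernel s δ) (regForce s δ z) z := by
  have h : 0 < |z| + δ := add_pos_of_nonneg_of_pos (abs_nonneg z) hδ
  have habs : HasDerivAt (fun x : ℝ => |x| + δ) (z / |z|) z := by
    refine HasDerivAt.add_const δ ?_
    rcases lt_or_gt_of_ne hz with h | h
    · rw [abs_of_neg h, div_neg, div_self hz]
      exact hasDerivAt_abs_neg h
    · rw [abs_of_pos h, div_self hz]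
      exact hasDerivAt_abs_pos h
  exact (hasDerivAt_rieszKernel h).comp z habs

lemma tendsto_regKernel (s : ℝ) {z : ℝ} (hz : z ≠ 0) :
    Tendsto (fun δ => regKernel s δ z) (𝓝[>] 0) (𝓝 (rieszKernel s z)) := by
  rw [← rieszKernel_abs s z]
  have h1 : Tendsto (fun δ : ℝ => |z| + δ) (𝓝[>] 0) (𝓝 |z|) := by
    have : Tendsto (fun δ : ℝ => |z| + δ) (𝓝 0) (𝓝 (|z| + 0)) :=
      tendsto_const_nhds.add tendsto_id
    rw [add_zero] at this
    exact this.mono_left nhdsWithin_le_nhds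
  exact (hasDerivAt_rieszKernel (abs_pos.2 hz)).continuousAt.tendsto.comp h1

lemma tendsto_regForce (s z : ℝ) :
    Tendsto (fun δ => regForce s δ z) (𝓝[>] 0) (𝓝 (regForce s 0 z)) := by
  by_cases hz : z = 0
  · simp [regForce, hz]
  · have h : |z| + 0 ≠ 0 := by simpa using hz
    have : ContinuousAt (fun δ => regForce s δ z) 0 := by
      unfold regForce
      refine ContinuousAt.mul (ContinuousAt.neg (continuousAt_const.mul ?_)) continuousAt_const
      exact ContinuousAt.rpow_const (by fun_prop) (Or.inl h)
    exact this.tendsto.mono_left nhdsWithin_le_nhds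

/-! ### Tangent inequality for the interaction energy of the shifted kernel -/

/-- The derivative of the potential `x ↦ ∫ W(|x - y| + δ) dμ(y)`. -/
noncomputable def regField (s δ : ℝ) (μ : Measure ℝ) (x : ℝ) : ℝ :=
  ∫ y, regForce s δ (x - y) ∂μ

lemma ae_prod_fst_ne_snd {ν : Measure ℝ} [SFinite ν] [NullSingletonClass ν] :
    ∀ᵐ p ∂(ν.prod ν), p.1 ≠ p.2 := by
  have hm : MeasurableSet {p : ℝ × ℝ | p.1 = p.2} :=
    measurableSet_eq_fun measurable_fst measurable_snd
  have : (ν.prod ν) {p : ℝ × ℝ | p.1 = p.2} = 0 := by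
    rw [Measure.measure_prod_null hm]
    refine Eventually.of_forall fun x => ?_
    have : Prod.mk x ⁻¹' {p : ℝ × ℝ | p.1 = p.2} = {x} := by
      ext y
      exact eq_comm
    change ν (Prod.mk x ⁻¹' {p : ℝ × ℝ | p.1 = p.2}) = 0
    rw [this]
    exact measure_singleton x
  rw [ae_iff]
  simpa only [ne_eq, not_not] using this

section

variable {μ : Measure ℝ} [IsProbabilityMeasure μ]

lemma integrable_abs_sub (hμ : Integrable (fun x : ℝ => x) μ) :
    Integrable (fun p : ℝ × ℝ => |p.1 - p.2|) (μ.prod μ) := by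
  have := ((hμ.comp_fst μ).sub (hμ.comp_snd μ)).abs
  exact this

lemma integrable_regKernel_sub {s δ : ℝ} (hs0 : 0 < s) (hs1 : s ≤ 1) (hδ : 0 < δ)
    (hμ : Integrable (fun x : ℝ => x) μ) :
    Integrable (fun p : ℝ × ℝ => regKernel s δ (p.1 - p.2)) (μ.prod μ) := by
  have hb : Integrable (fun p : ℝ × ℝ =>
      |rieszKernel s δ| + rieszGrowth s * (1 + |p.1 - p.2| + δ)) (μ.prod μ) :=
    (integrable_const _).add ((((integrable_const (1 : ℝ)).add (integrable_abs_sub hμ)).add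
      (integrable_const δ)).const_mul _)
  refine Integrable.mono' hb ?_ (Eventually.of_forall fun p => abs_regKernel_le hs0 hs1 hδ _)
  exact ((measurable_regKernel s δ).comp
    (measurable_fst.sub measurable_snd)).aestronglyMeasurable

/-- Displacement convexity of the regularised interaction energy, in the form of a tangent
inequality. -/
lemma regInteraction_tangent_le {s δ : ℝ} (hs0 : 0 < s) (hs1 : s ≤ 1) (hδ : 0 < δ)
    {T : ℝ → ℝ} (hT : Measurable T) {J : Set ℝ} (hJ : ∀ᵐ x ∂μ, x ∈ J) (hTm : MonotoneOn T J)
    (hμ : Integrable (fun x : ℝ => x) μ) (hTi : Integrable T μ) :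
    ∫ p, regKernel s δ (p.1 - p.2) ∂(μ.prod μ) + 2 * ∫ x, (T x - x) * regField s δ μ x ∂μ
      ≤ ∫ p, regKernel s δ (p.1 - p.2) ∂((μ.map T).prod (μ.map T)) := by
  have : IsProbabilityMeasure (μ.map T) := Measure.isProbabilityMeasure_map hT.aemeasurable
  have hTν : Integrable (fun x : ℝ => x) (μ.map T) := by
    rw [integrable_map_measure (by fun_prop) hT.aemeasurable]
    exact hTi
  have hmap : (μ.prod μ).map (Prod.map T T) = (μ.map T).prod (μ.map T) :=
    (Measure.map_prod_map μ μ hT hT).symm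
  have hν := integrable_regKernel_sub hs0 hs1 hδ hTν
  have e1 := integral_comp_of_map_eq (hT.prodMap hT) hmap hν.1
  have i1 := integrable_comp_of_map_eq (hT.prodMap hT) hmap hν
  have i0 := integrable_regKernel_sub hs0 hs1 hδ hμ
  have hξ : Integrable (fun x => T x - x) μ := hTi.sub hμ
  have hfm : AEStronglyMeasurable (fun p : ℝ × ℝ => regForce s δ (p.1 - p.2)) (μ.prod μ) :=
    ((measurable_regForce s δ).comp (measurable_fst.sub measurable_snd)).aestronglyMeasurable
  have hfb : ∀ᵐ p ∂(μ.prod μ),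
      ‖regForce s δ (p.1 - p.2)‖ ≤ rieszSlope s * δ ^ (2 * s - 2) :=
    Eventually.of_forall fun p => abs_regForce_le_const hs0 hs1 hδ _
  have j1 : Integrable (fun p : ℝ × ℝ => (T p.1 - p.1) * regForce s δ (p.1 - p.2)) (μ.prod μ) :=
    (hξ.comp_fst μ).mul_bdd hfm hfb
  have j2 : Integrable (fun p : ℝ × ℝ => (T p.2 - p.2) * regForce s δ (p.1 - p.2)) (μ.prod μ) :=
    (hξ.comp_snd μ).mul_bdd hfm hfb
  have f1 : ∫ p : ℝ × ℝ, (T p.1 - p.1) * regForce s δ (p.1 - p.2) ∂(μ.prod μ)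
      = ∫ x, (T x - x) * regField s δ μ x ∂μ := by
    rw [integral_prod _ j1]
    simp only [integral_const_mul]
    rfl
  -- The force is odd, so that exchanging the two variables changes the sign.
  have f2 : ∫ p : ℝ × ℝ, (T p.2 - p.2) * regForce s δ (p.1 - p.2) ∂(μ.prod μ)
      = -∫ x, (T x - x) * regField s δ μ x ∂μ := by
    rw [← f1, ← integral_prod_swap, ← integral_neg]
    refine integral_congr_ae (Eventually.of_forall fun p => ?_)
    simp only [Prod.fst_swap, Prod.snd_swap]
    rw [← neg_sub p.1 p.2, regForce_neg]
    ring
  have key : ∫ p : ℝ × ℝ, (regKernel s δ (p.1 - p.2) -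
        (T p.2 - p.2) * regForce s δ (p.1 - p.2) + (T p.1 - p.1) * regForce s δ (p.1 - p.2))
        ∂(μ.prod μ)
      ≤ ∫ p : ℝ × ℝ, regKernel s δ (T p.1 - T p.2) ∂(μ.prod μ) := by
    refine integral_mono_ae ((i0.sub j2).add j1) i1 ?_
    filter_upwards [Measure.quasiMeasurePreserving_fst.ae hJ,
      Measure.quasiMeasurePreserving_snd.ae hJ] with p hp1 hp2
    have h0 : p.1 - p.2 = 0 → T p.1 - T p.2 = 0 := fun h => by
      rw [sub_eq_zero.1 h, sub_self]
    have h1 : 0 ≤ (p.1 - p.2) * (T p.1 - T p.2) := by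
      rcases le_total p.1 p.2 with h | h
      · exact mul_nonneg_of_nonpos_of_nonpos (sub_nonpos.2 h) (sub_nonpos.2 (hTm hp1 hp2 h))
      · exact mul_nonneg (sub_nonneg.2 h) (sub_nonneg.2 (hTm hp2 hp1 h))
    have := regKernel_tangent_le hs0 hs1 hδ h0 h1
    linarith
  rw [integral_sub_add i0 j2 j1, f1, f2] at key
  simp only [Prod.map_fst, Prod.map_snd] at e1
  linarith

end

/-! ### Measures with a bounded density -/

section

variable {ρ : ℝ → ℝ} (hρ0 : ∀ x, 0 ≤ ρ x) (hρm : Measurable ρ)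

include hρ0 hρm

lemma integrable_densityMeasure {f : ℝ → ℝ} :
    Integrable f (densityMeasure ρ) ↔ Integrable (fun x => ρ x * f x) volume := by
  rw [densityMeasure, integrable_withDensity_iff_integrable_smul' hρm.ennreal_ofReal
    (Eventually.of_forall fun x => ENNReal.ofReal_lt_top)]
  simp only [ENNReal.toReal_ofReal (hρ0 _), smul_eq_mul]

lemma integral_densityMeasure (f : ℝ → ℝ) :
    ∫ x, f x ∂(densityMeasure ρ) = ∫ x, ρ x * f x := by
  rw [densityMeasure, integral_withDensity_eq_integral_toReal_smul hρm.ennreal_ofReal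
    (Eventually.of_forall fun x => ENNReal.ofReal_lt_top)]
  simp only [ENNReal.toReal_ofReal (hρ0 _), smul_eq_mul]

end

lemma isProbabilityMeasure_densityMeasure {ρ : ℝ → ℝ} (hρ0 : ∀ x, 0 ≤ ρ x)
    (hρ1 : Integrable ρ volume) (hmass : ∫ x, ρ x = 1) :
    IsProbabilityMeasure (densityMeasure ρ) := by
  constructor
  rw [densityMeasure, withDensity_apply _ MeasurableSet.univ, Measure.restrict_univ,
    ← ofReal_integral_eq_lintegral_ofReal hρ1 (Eventually.of_forall hρ0), hmass,
    ENNReal.ofReal_one]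

lemma densityMeasure_absolutelyContinuous (ρ : ℝ → ℝ) : densityMeasure ρ ≪ volume :=
  withDensity_absolutelyContinuous _ _

lemma nullSingletonClass_of_absolutelyContinuous {μ : Measure ℝ} (h : μ ≪ volume) :
    NullSingletonClass μ :=
  ⟨fun x => h (measure_singleton x)⟩

lemma densityMeasure_le {ρ : ℝ → ℝ} {M : ℝ} (hM : ∀ x, ρ x ≤ M) :
    densityMeasure ρ ≤ ENNReal.ofReal M • volume := by
  rw [← withDensity_const]
  exact withDensity_mono (Eventually.of_forall fun x => ENNReal.ofReal_le_ofReal (hM x))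

lemma integrable_sub_left_of_le {μ : Measure ℝ} {M : ℝ} (hM : μ ≤ ENNReal.ofReal M • volume)
    {h : ℝ → ℝ} (hh : Integrable h volume) (x : ℝ) : Integrable (fun y => h (x - y)) μ :=
  ((hh.comp_sub_left x).smul_measure ENNReal.ofReal_ne_top).mono_measure hM

section

variable {μ : Measure ℝ} [IsProbabilityMeasure μ] {M : ℝ} (hM : μ ≤ ENNReal.ofReal M • volume)

include hM

lemma integrable_sub_prod_of_le {h : ℝ → ℝ} (hh : Integrable h volume) (hhm : Measurable h) :
    Integrable (fun p : ℝ × ℝ => h (p.1 - p.2)) (μ.prod μ) := by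
  have hm : AEStronglyMeasurable (fun p : ℝ × ℝ => h (p.1 - p.2)) (μ.prod μ) :=
    (hhm.comp (measurable_fst.sub measurable_snd)).aestronglyMeasurable
  rw [integrable_prod_iff hm]
  refine ⟨Eventually.of_forall fun x => integrable_sub_left_of_le hM hh x, ?_⟩
  refine Integrable.mono' (integrable_const ((ENNReal.ofReal M).toReal * ∫ z, ‖h z‖))
    hm.norm.integral_prod_right' (Eventually.of_forall fun x => ?_)
  rw [Real.norm_of_nonneg (integral_nonneg fun _ => norm_nonneg _)]
  have := integral_mono_measure hM (f := fun y => ‖h (x - y)‖)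
    (Eventually.of_forall fun _ => norm_nonneg _)
    ((hh.comp_sub_left x).norm.smul_measure ENNReal.ofReal_ne_top)
  rw [integral_smul_measure, smul_eq_mul,
    integral_sub_left_eq_self (fun z => ‖h z‖) volume x] at this
  exact this

lemma integrable_rieszKernel_sub_left {s : ℝ} (hs0 : 0 < s) (hs1 : s ≤ 1)
    (hμ : Integrable (fun x : ℝ => x) μ) (x : ℝ) :
    Integrable (fun y => rieszKernel s (x - y)) μ := by
  have hb : Integrable (fun y => rieszSingular s (x - y) + rieszGrowth s * (1 + |x - y|)) μ :=
    (integrable_sub_left_of_le hM (integrable_rieszSingular hs0) x).add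
      (((integrable_const (1 : ℝ)).add ((integrable_const x).sub hμ).abs).const_mul _)
  exact Integrable.mono' hb ((measurable_rieszKernel s).comp
    (measurable_const.sub measurable_id)).aestronglyMeasurable
    (Eventually.of_forall fun y => abs_rieszKernel_le hs0 hs1 _)

lemma integrable_rieszKernel_prod {s : ℝ} (hs0 : 0 < s) (hs1 : s ≤ 1)
    (hμ : Integrable (fun x : ℝ => x) μ) :
    Integrable (fun p : ℝ × ℝ => rieszKernel s (p.1 - p.2)) (μ.prod μ) := by
  have hm : Measurable (rieszSingular s) :=
    (measurable_rieszKernel s).norm.indicator measurableSet_Icc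
  have hb : Integrable (fun p : ℝ × ℝ =>
      rieszSingular s (p.1 - p.2) + rieszGrowth s * (1 + |p.1 - p.2|)) (μ.prod μ) :=
    (integrable_sub_prod_of_le hM (integrable_rieszSingular hs0) hm).add
      (((integrable_const (1 : ℝ)).add (integrable_abs_sub hμ)).const_mul _)
  exact Integrable.mono' hb ((measurable_rieszKernel s).comp
    (measurable_fst.sub measurable_snd)).aestronglyMeasurable
    (Eventually.of_forall fun p => abs_rieszKernel_le hs0 hs1 _)

end

/-! ### Removing the shift -/

lemma Ioc_mem_nhdsGT_zero : Ioc (0 : ℝ) 1 ∈ 𝓝[>] (0 : ℝ) :=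
  Ioc_mem_nhdsGT one_pos

lemma tendsto_integral_regKernel {Ω : Type*} [MeasurableSpace Ω] {P : Measure Ω}
    [IsFiniteMeasure P] {s : ℝ}
    (hs0 : 0 < s) (hs1 : s ≤ 1) {f : Ω → ℝ} (hf : Measurable f) (hf0 : ∀ᵐ ω ∂P, f ω ≠ 0)
    (hfi : Integrable f P) (hW : Integrable (fun ω => rieszKernel s (f ω)) P) :
    Tendsto (fun δ => ∫ ω, regKernel s δ (f ω) ∂P) (𝓝[>] 0)
      (𝓝 (∫ ω, rieszKernel s (f ω) ∂P)) := by
  refine tendsto_integral_filter_of_dominated_convergence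
    (fun ω => |rieszKernel s (f ω)| + rieszGrowth s * (2 + |f ω|)) ?_ ?_ ?_ ?_
  · exact Eventually.of_forall fun δ => ((measurable_regKernel s δ).comp hf).aestronglyMeasurable
  · filter_upwards [Ioc_mem_nhdsGT_zero] with δ hδ
    filter_upwards [hf0] with ω hω
    exact abs_regKernel_le_of_le_one hs0 hs1 hδ.1 hδ.2 hω
  · exact hW.abs.add (((integrable_const (2 : ℝ)).add hfi.abs).const_mul _)
  · filter_upwards [hf0] with ω hω
    exact tendsto_regKernel s hω

/-- The regularised potential is differentiable, with the regularised field as derivative. -/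
lemma hasDerivAt_integral_regKernel {μ : Measure ℝ} [IsProbabilityMeasure μ]
    [NullSingletonClass μ] {s δ : ℝ} (hs0 : 0 < s) (hs1 : s ≤ 1) (hδ : 0 < δ)
    (hμ : Integrable (fun x : ℝ => x) μ) (x : ℝ) :
    HasDerivAt (fun x => ∫ y, regKernel s δ (x - y) ∂μ) (regField s δ μ x) x := by
  have hm : ∀ x, AEStronglyMeasurable (fun y => regKernel s δ (x - y)) μ := fun x =>
    ((measurable_regKernel s δ).comp (measurable_const.sub measurable_id)).aestronglyMeasurable
  have hk : 0 ≤ rieszSlope s * δ ^ (2 * s - 2) :=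
    mul_nonneg (rieszSlope_pos hs0 hs1).le (Real.rpow_nonneg hδ.le _)
  refine (hasDerivAt_integral_of_dominated_loc_of_lip (μ := μ) (s := univ)
    (F := fun x y => regKernel s δ (x - y)) (F' := fun y => regForce s δ (x - y))
    (bound := fun _ => rieszSlope s * δ ^ (2 * s - 2)) univ_mem
    (Eventually.of_forall hm) ?_ ?_ ?_ (integrable_const _) ?_).2
  · have hb : Integrable (fun y =>
        |rieszKernel s δ| + rieszGrowth s * (1 + |x - y| + δ)) μ :=
      (integrable_const _).add ((((integrable_const (1 : ℝ)).add
        ((integrable_const x).sub hμ).abs).add (integrable_const δ)).const_mul _)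
    exact Integrable.mono' hb (hm x) (Eventually.of_forall fun y => abs_regKernel_le hs0 hs1 hδ _)
  · exact ((measurable_regForce s δ).comp
      (measurable_const.sub measurable_id)).aestronglyMeasurable
  · refine Eventually.of_forall fun y => LipschitzOnWith.of_dist_le_mul fun a _ b _ => ?_
    rw [Real.dist_eq, Real.dist_eq, Real.coe_nnabs, abs_of_nonneg hk]
    have := lipschitz_regKernel hs0 hs1 hδ (a - y) (b - y)
    rwa [sub_sub_sub_cancel_right] at this
  · have hne : ∀ᵐ y ∂μ, y ≠ x := by
      rw [ae_iff]
      simp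
    filter_upwards [hne] with y hy
    have h1 := hasDerivAt_regKernel (s := s) hδ (sub_ne_zero.2 hy.symm)
    have h2 : HasDerivAt (fun x => x - y) 1 x := (hasDerivAt_id x).sub_const y
    have h3 : HasDerivAt (fun x => regKernel s δ (x - y)) (regForce s δ (x - y) * 1) x :=
      HasDerivAt.comp (h₂ := regKernel s δ) (h := fun x => x - y) x h1 h2
    exact h3.congr_deriv (mul_one _)

/-! ### The derivative of the Riesz potential of a Hölder density -/

/-- The principal value `PV ∫ W'(x - y) ρ(y) dy`, in the symmetrised form
`½ ∫ W'(z) (ρ(x - z) - ρ(x + z)) dz`, an absolutely convergent integral if `ρ` is `α`-Hölder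
with `α > 1 - 2 s`. -/
noncomputable def rieszField (s : ℝ) (ρ : ℝ → ℝ) (x : ℝ) : ℝ :=
  1 / 2 * ∫ z, regForce s 0 z * (ρ (x - z) - ρ (x + z))

/-- An integrable majorant for the symmetrised force. -/
noncomputable def fieldBound (s α C : ℝ) (ρ : ℝ → ℝ) (x z : ℝ) : ℝ :=
  rieszSlope s * (C * indicator (Icc (-1) 1) (fun z => |z| ^ (2 * s - 2 + α)) z
    + (ρ (x - z) + ρ (x + z)))

section

variable {s : ℝ} {ρ : ℝ → ℝ} (hs0 : 0 < s) (hs1 : s ≤ 1) (hρ0 : ∀ x, 0 ≤ ρ x)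

lemma integrable_abs_rpow_indicator {β : ℝ} (hβ : -1 < β) :
    Integrable (indicator (Icc (-1) 1) fun z : ℝ => |z| ^ β) volume := by
  refine integrable_indicator_Icc_of_even (fun x => by rw [abs_neg]) ?_
  have : IntervalIntegrable (fun x : ℝ => x ^ β) volume 0 1 :=
    intervalIntegral.intervalIntegrable_rpow' hβ
  refine this.congr_ae ?_
  rw [uIoc_of_le zero_le_one]
  refine (ae_restrict_iff' measurableSet_Ioc).2 (Eventually.of_forall fun x hx => ?_)
  simp only [abs_of_pos hx.1]

lemma integral_comp_add_sub_eq (hρ1 : Integrable ρ volume) (x : ℝ) :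
    ∫ z, (ρ (x - z) + ρ (x + z)) = 2 * ∫ z, ρ z := by
  rw [integral_add (hρ1.comp_sub_left x) (hρ1.comp_add_left x),
    integral_sub_left_eq_self ρ volume x, integral_add_left_eq_self ρ x]
  ring

lemma integrable_fieldBound {α C : ℝ} (hα : 1 - 2 * s < α) (hρ1 : Integrable ρ volume) (x : ℝ) :
    Integrable (fieldBound s α C ρ x) volume :=
  (((integrable_abs_rpow_indicator (by linarith)).const_mul C).add
    ((hρ1.comp_sub_left x).add (hρ1.comp_add_left x))).const_mul _

lemma integral_fieldBound {α C : ℝ} (hα : 1 - 2 * s < α) (hρ1 : Integrable ρ volume) (x : ℝ) :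
    ∫ z, fieldBound s α C ρ x z = rieszSlope s *
      (C * (∫ z, indicator (Icc (-1) 1) (fun z : ℝ => |z| ^ (2 * s - 2 + α)) z)
        + 2 * ∫ z, ρ z) := by
  have h1 : Integrable (fun z : ℝ =>
      C * indicator (Icc (-1) 1) (fun z : ℝ => |z| ^ (2 * s - 2 + α)) z) volume :=
    (integrable_abs_rpow_indicator (by linarith)).const_mul C
  have h2 : Integrable (fun z => ρ (x - z) + ρ (x + z)) volume :=
    (hρ1.comp_sub_left x).add (hρ1.comp_add_left x)
  unfold fieldBound
  rw [integral_const_mul, integral_add h1 h2, integral_const_mul,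
    integral_comp_add_sub_eq hρ1 x]

include hs0 hs1 hρ0

lemma abs_regForce_mul_le {α C δ : ℝ} (hC : 0 ≤ C)
    (hHol : ∀ x z, |ρ (x - z) - ρ (x + z)| ≤ C * |z| ^ α) (hδ : 0 ≤ δ) (x z : ℝ) :
    |regForce s δ z * (ρ (x - z) - ρ (x + z))| ≤ fieldBound s α C ρ x z := by
  have hk := (rieszSlope_pos hs0 hs1).le
  have hp1 := hρ0 (x - z)
  have hp2 := hρ0 (x + z)
  by_cases hz : z = 0
  · rw [hz, regForce, zero_div, mul_zero, zero_mul, abs_zero]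
    refine mul_nonneg hk (add_nonneg (mul_nonneg hC (indicator_nonneg (fun z _ => ?_) _))
      (add_nonneg (hρ0 _) (hρ0 _)))
    exact Real.rpow_nonneg (abs_nonneg z) _
  · have hz' := abs_pos.2 hz
    have h1 := abs_regForce_le_rpow hs0 hs1 hδ hz
    rw [abs_mul]
    refine (mul_le_mul_of_nonneg_right h1 (abs_nonneg _)).trans ?_
    rw [fieldBound, mul_assoc]
    refine mul_le_mul_of_nonneg_left ?_ hk
    by_cases hI : z ∈ Icc (-1 : ℝ) 1
    · rw [indicator_of_mem hI, Real.rpow_add hz']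
      have := mul_le_mul_of_nonneg_left (hHol x z) (Real.rpow_nonneg hz'.le (2 * s - 2))
      linarith
    · rw [indicator_of_notMem hI, mul_zero, zero_add]
      have h2 : 1 ≤ |z| := by
        by_contra! h'
        exact hI (abs_le.1 h'.le)
      have h3 : |z| ^ (2 * s - 2) ≤ 1 := Real.rpow_le_one_of_one_le_of_nonpos h2 (by linarith)
      refine (mul_le_of_le_one_left (abs_nonneg _) h3).trans ?_
      rw [abs_le]
      constructor <;> linarith

lemma regField_densityMeasure {δ : ℝ} (hδ : 0 < δ) (hρm : Measurable ρ)
    (hρ1 : Integrable ρ volume) (x : ℝ) :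
    regField s δ (densityMeasure ρ) x
      = 1 / 2 * ∫ z, regForce s δ z * (ρ (x - z) - ρ (x + z)) := by
  have hfm := (measurable_regForce s δ).aestronglyMeasurable (μ := volume)
  have hfb : ∀ᵐ z : ℝ, ‖regForce s δ z‖ ≤ rieszSlope s * δ ^ (2 * s - 2) :=
    Eventually.of_forall fun z => abs_regForce_le_const hs0 hs1 hδ z
  have i1 : Integrable (fun z => regForce s δ z * ρ (x - z)) volume :=
    (hρ1.comp_sub_left x).bdd_mul hfm hfb
  have i2 : Integrable (fun z => regForce s δ z * ρ (x + z)) volume :=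
    (hρ1.comp_add_left x).bdd_mul hfm hfb
  have e1 : regField s δ (densityMeasure ρ) x = ∫ z, regForce s δ z * ρ (x - z) := by
    rw [regField, integral_densityMeasure hρ0 hρm, ← integral_sub_left_eq_self _ volume x]
    simp only [sub_sub_cancel, mul_comm]
  have e2 : ∫ z, regForce s δ z * ρ (x + z) = -∫ z, regForce s δ z * ρ (x - z) := by
    rw [← integral_neg_eq_self, ← integral_neg]
    simp only [regForce_neg, neg_mul, ← sub_eq_add_neg]
  simp only [mul_sub]
  rw [integral_sub i1 i2, e1, e2]
  ring

/-- The regularised fields of a Hölder density are bounded uniformly in the shift and converge. -/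
lemma regField_bound_and_tendsto {α C : ℝ} (hα : 1 - 2 * s < α) (hC : 0 ≤ C)
    (hHol : ∀ x z, |ρ (x - z) - ρ (x + z)| ≤ C * |z| ^ α) (hρm : Measurable ρ)
    (hρ1 : Integrable ρ volume) :
    (∃ B, ∀ δ, 0 < δ → ∀ x, |regField s δ (densityMeasure ρ) x| ≤ B) ∧
      ∀ x, Tendsto (fun δ => regField s δ (densityMeasure ρ) x) (𝓝[>] 0)
        (𝓝 (rieszField s ρ x)) := by
  constructor
  · refine ⟨1 / 2 * (rieszSlope s *
      (C * (∫ z, indicator (Icc (-1) 1) (fun z : ℝ => |z| ^ (2 * s - 2 + α)) z)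
        + 2 * ∫ z, ρ z)), fun δ hδ x => ?_⟩
    rw [regField_densityMeasure hs0 hs1 hρ0 hδ hρm hρ1, abs_mul, abs_of_pos (by norm_num),
      ← integral_fieldBound hα hρ1 x]
    refine mul_le_mul_of_nonneg_left ?_ (by norm_num)
    exact norm_integral_le_of_norm_le
      (f := fun z => regForce s δ z * (ρ (x - z) - ρ (x + z)))
      (integrable_fieldBound (C := C) hα hρ1 x)
      (Eventually.of_forall fun z => abs_regForce_mul_le hs0 hs1 hρ0 hC hHol hδ.le x z)
  · intro x
    have h : Tendsto (fun δ => 1 / 2 * ∫ z, regForce s δ z * (ρ (x - z) - ρ (x + z))) (𝓝[>] 0)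
        (𝓝 (rieszField s ρ x)) := by
      refine Tendsto.const_mul _ ?_
      refine tendsto_integral_filter_of_dominated_convergence
        (F := fun δ z => regForce s δ z * (ρ (x - z) - ρ (x + z))) (fieldBound s α C ρ x) ?_ ?_
        (integrable_fieldBound hα hρ1 x) ?_
      · refine Eventually.of_forall fun δ => Measurable.aestronglyMeasurable ?_
        have := measurable_regForce s δ
        fun_prop
      · filter_upwards [self_mem_nhdsWithin] with δ hδ
        exact Eventually.of_forall fun z =>
          abs_regForce_mul_le hs0 hs1 hρ0 hC hHol (le_of_lt hδ) x z
      · exact Eventually.of_forall fun z => (tendsto_regForce s z).mul_const _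
    refine h.congr' ?_
    filter_upwards [self_mem_nhdsWithin] with δ hδ
    exact (regField_densityMeasure hs0 hs1 hρ0 hδ hρm hρ1 x).symm

end

lemma measurable_regField {μ : Measure ℝ} [IsProbabilityMeasure μ]
    [NullSingletonClass μ] {s δ : ℝ} (hs0 : 0 < s) (hs1 : s ≤ 1) (hδ : 0 < δ)
    (hμ : Integrable (fun x : ℝ => x) μ) : Measurable (regField s δ μ) := by
  have : regField s δ μ = deriv fun x => ∫ y, regKernel s δ (x - y) ∂μ :=
    funext fun x => (hasDerivAt_integral_regKernel hs0 hs1 hδ hμ x).deriv.symm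
  rw [this]
  exact measurable_deriv _

section

variable {s : ℝ} {ρ : ℝ → ℝ} {α C M : ℝ}

lemma measurable_rieszField (hs0 : 0 < s) (hs1 : s ≤ 1)
    (hρ0 : ∀ x, 0 ≤ ρ x) (hρm : Measurable ρ) (hρ1 : Integrable ρ volume) (hmass : ∫ x, ρ x = 1)
    (hμ : Integrable (fun x : ℝ => x) (densityMeasure ρ)) (hα : 1 - 2 * s < α) (hC : 0 ≤ C)
    (hHol : ∀ x z, |ρ (x - z) - ρ (x + z)| ≤ C * |z| ^ α) : Measurable (rieszField s ρ) := by
  have := isProbabilityMeasure_densityMeasure hρ0 hρ1 hmass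
  have := nullSingletonClass_of_absolutelyContinuous (densityMeasure_absolutelyContinuous ρ)
  have hlim := (regField_bound_and_tendsto hs0 hs1 hρ0 hα hC hHol hρm hρ1).2
  -- replace the fields at nonpositive shifts, where measurability is not known, by zero
  refine measurable_of_tendsto_metrizable' (𝓝[>] (0 : ℝ))
    (f := fun δ => if 0 < δ then regField s δ (densityMeasure ρ) else 0) (fun δ => ?_) ?_
  · split_ifs with h
    · exact measurable_regField hs0 hs1 h hμ
    · exact measurable_const
  · rw [tendsto_pi_nhds]
    intro x
    refine (hlim x).congr' ?_
    filter_upwards [self_mem_nhdsWithin] with δ hδ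
    rw [if_pos (mem_Ioi.1 hδ)]

lemma exists_abs_rieszField_le (hs0 : 0 < s) (hs1 : s ≤ 1)
    (hρ0 : ∀ x, 0 ≤ ρ x) (hρm : Measurable ρ) (hρ1 : Integrable ρ volume)
    (hα : 1 - 2 * s < α) (hC : 0 ≤ C)
    (hHol : ∀ x z, |ρ (x - z) - ρ (x + z)| ≤ C * |z| ^ α) :
    ∃ B, ∀ x, |rieszField s ρ x| ≤ B := by
  obtain ⟨⟨B, hB⟩, hlim⟩ := regField_bound_and_tendsto hs0 hs1 hρ0 hα hC hHol hρm hρ1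
  refine ⟨B, fun x => le_of_tendsto (hlim x).abs ?_⟩
  filter_upwards [self_mem_nhdsWithin] with δ hδ
  exact hB δ hδ x

/-- The Riesz potential of a Hölder density is a primitive of the principal value field: pass to the
limit `δ → 0` in the fundamental theorem of calculus for the shifted kernels. -/
lemma ae_deriv_rieszPotential (hs0 : 0 < s) (hs1 : s ≤ 1)
    (hρ0 : ∀ x, 0 ≤ ρ x) (hρm : Measurable ρ) (hρ1 : Integrable ρ volume) (hmass : ∫ x, ρ x = 1)
    (hM : ∀ x, ρ x ≤ M) (hμ : Integrable (fun x : ℝ => x) (densityMeasure ρ))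
    (hα : 1 - 2 * s < α) (hC : 0 ≤ C) (hHol : ∀ x z, |ρ (x - z) - ρ (x + z)| ≤ C * |z| ^ α) :
    ∀ᵐ x, deriv (rieszPotential s ρ) x = rieszField s ρ x := by
  set μ := densityMeasure ρ with hμdef
  have : IsProbabilityMeasure μ := isProbabilityMeasure_densityMeasure hρ0 hρ1 hmass
  have : NullSingletonClass μ :=
    nullSingletonClass_of_absolutelyContinuous (densityMeasure_absolutelyContinuous ρ)
  obtain ⟨⟨B, hB⟩, hlim⟩ := regField_bound_and_tendsto hs0 hs1 hρ0 hα hC hHol hρm hρ1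
  obtain ⟨B', hB'⟩ := exists_abs_rieszField_le hs0 hs1 hρ0 hρm hρ1 hα hC hHol
  have hqm := measurable_rieszField hs0 hs1 hρ0 hρm hρ1 hmass hμ hα hC hHol
  have hp : ∀ x, rieszPotential s ρ x = ∫ y, rieszKernel s (x - y) ∂μ := fun x => by
    rw [integral_densityMeasure hρ0 hρm, rieszPotential]
    simp only [mul_comm]
  have hreg : ∀ δ, 0 < δ → ∀ x, ∫ t in (0 : ℝ)..x, regField s δ μ t
      = ∫ y, regKernel s δ (x - y) ∂μ - ∫ y, regKernel s δ (0 - y) ∂μ := by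
    intro δ hδ x
    refine intervalIntegral.integral_eq_sub_of_hasDerivAt
      (fun t _ => hasDerivAt_integral_regKernel hs0 hs1 hδ hμ t) ?_
    refine (intervalIntegrable_const (c := B)).mono_fun
      (measurable_regField hs0 hs1 hδ hμ).aestronglyMeasurable
      (Eventually.of_forall fun t => ?_)
    exact (hB δ hδ t).trans (le_abs_self B)
  have hlimp : ∀ x, Tendsto (fun δ => ∫ y, regKernel s δ (x - y) ∂μ) (𝓝[>] 0)
      (𝓝 (rieszPotential s ρ x)) := by
    intro x
    rw [hp]
    have hne : ∀ᵐ y ∂μ, x - y ≠ 0 := by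
      have : ∀ᵐ y ∂μ, y ≠ x := by
        rw [ae_iff]
        simp
      filter_upwards [this] with y hy
      exact sub_ne_zero.2 hy.symm
    exact tendsto_integral_regKernel hs0 hs1 (measurable_const.sub measurable_id) hne
      ((integrable_const x).sub hμ)
      (integrable_rieszKernel_sub_left (densityMeasure_le hM) hs0 hs1 hμ x)
  have hprim : ∀ x, rieszPotential s ρ x
      = rieszPotential s ρ 0 + ∫ t in (0 : ℝ)..x, rieszField s ρ t := by
    intro x
    have h1 : Tendsto (fun δ => ∫ t in (0 : ℝ)..x, regField s δ μ t) (𝓝[>] 0)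
        (𝓝 (∫ t in (0 : ℝ)..x, rieszField s ρ t)) := by
      refine intervalIntegral.tendsto_integral_filter_of_dominated_convergence (fun _ => B)
        ?_ ?_ intervalIntegrable_const (Eventually.of_forall fun t _ => hlim t)
      · filter_upwards [self_mem_nhdsWithin] with δ hδ
        exact (measurable_regField hs0 hs1 hδ hμ).aestronglyMeasurable
      · filter_upwards [self_mem_nhdsWithin] with δ hδ
        exact Eventually.of_forall fun t _ => hB δ hδ t
    have h2 := (hlimp x).sub (hlimp 0)
    have h3 := tendsto_nhds_unique (h1.congr' (by
      filter_upwards [self_mem_nhdsWithin] with δ hδ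
      exact hreg δ hδ x)) h2
    rw [h3]
    ring
  have hli : LocallyIntegrable (rieszField s ρ) volume :=
    (locallyIntegrable_const B').mono hqm.aestronglyMeasurable
      (Eventually.of_forall fun x => (hB' x).trans (le_abs_self B'))
  filter_upwards [_root_.LocallyIntegrable.ae_hasDerivAt_integral hli] with x hx
  rw [funext hprim]
  exact ((hx 0).const_add _).deriv

/-! ### Tangent inequality for the interaction energy -/

/-- Displacement convexity of the interaction energy, in the form of a tangent inequality at a
Hölder density. -/
lemma interaction_tangent_le (hs0 : 0 < s) (hs1 : s ≤ 1)
    (hρ0 : ∀ x, 0 ≤ ρ x) (hρm : Measurable ρ) (hρ1 : Integrable ρ volume) (hmass : ∫ x, ρ x = 1)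
    (hM : ∀ x, ρ x ≤ M) (hμ : Integrable (fun x : ℝ => x) (densityMeasure ρ))
    (hα : 1 - 2 * s < α) (hC : 0 ≤ C) (hHol : ∀ x z, |ρ (x - z) - ρ (x + z)| ≤ C * |z| ^ α)
    {ν : Measure ℝ} [IsProbabilityMeasure ν] [NullSingletonClass ν]
    (hν : Integrable (fun x : ℝ => x) ν)
    (hW : Integrable (fun p : ℝ × ℝ => rieszKernel s (p.1 - p.2)) (ν.prod ν)) :
    ∫ p, rieszKernel s (p.1 - p.2) ∂((densityMeasure ρ).prod (densityMeasure ρ))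
        + 2 * ∫ x, (monotoneMap (densityMeasure ρ) ν x - x) * rieszField s ρ x ∂(densityMeasure ρ)
      ≤ ∫ p, rieszKernel s (p.1 - p.2) ∂(ν.prod ν) := by
  set μ := densityMeasure ρ with hμdef
  have : IsProbabilityMeasure μ := isProbabilityMeasure_densityMeasure hρ0 hρ1 hmass
  have : NullSingletonClass μ :=
    nullSingletonClass_of_absolutelyContinuous (densityMeasure_absolutelyContinuous ρ)
  obtain ⟨⟨B, hB⟩, hlim⟩ := regField_bound_and_tendsto hs0 hs1 hρ0 hα hC hHol hρm hρ1
  have hT := measurable_monotoneMap μ ν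
  have hmap := map_monotoneMap μ ν
  have hTi : Integrable (monotoneMap μ ν) μ :=
    integrable_comp_of_map_eq (g := fun x => x) hT hmap hν
  have hle : ∀ δ, 0 < δ → ∫ p, regKernel s δ (p.1 - p.2) ∂(μ.prod μ)
      + 2 * ∫ x, (monotoneMap μ ν x - x) * regField s δ μ x ∂μ
      ≤ ∫ p, rieszKernel s (p.1 - p.2) ∂(ν.prod ν) := by
    intro δ hδ
    have h1 := regInteraction_tangent_le hs0 hs1 hδ hT (ae_mem_cdfSupport μ)
      (monotoneOn_monotoneMap μ ν) hμ hTi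
    rw [hmap] at h1
    refine h1.trans (integral_mono_ae (integrable_regKernel_sub hs0 hs1 hδ hν) hW ?_)
    filter_upwards [ae_prod_fst_ne_snd (ν := ν)] with p hp
    exact regKernel_le hs0 hs1 hδ (sub_ne_zero.2 hp)
  have l1 : Tendsto (fun δ => ∫ p : ℝ × ℝ, regKernel s δ (p.1 - p.2) ∂(μ.prod μ)) (𝓝[>] 0)
      (𝓝 (∫ p : ℝ × ℝ, rieszKernel s (p.1 - p.2) ∂(μ.prod μ))) := by
    refine tendsto_integral_regKernel hs0 hs1 (measurable_fst.sub measurable_snd) ?_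
      ((hμ.comp_fst μ).sub (hμ.comp_snd μ))
      (integrable_rieszKernel_prod (densityMeasure_le hM) hs0 hs1 hμ)
    filter_upwards [ae_prod_fst_ne_snd (ν := μ)] with p hp
    exact sub_ne_zero.2 hp
  have l2 : Tendsto (fun δ => ∫ x, (monotoneMap μ ν x - x) * regField s δ μ x ∂μ) (𝓝[>] 0)
      (𝓝 (∫ x, (monotoneMap μ ν x - x) * rieszField s ρ x ∂μ)) := by
    refine tendsto_integral_filter_of_dominated_convergence
      (F := fun δ x => (monotoneMap μ ν x - x) * regField s δ μ x)
      (fun x => |monotoneMap μ ν x - x| * B) ?_ ?_ ((hTi.sub hμ).abs.mul_const B)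
      (Eventually.of_forall fun x => (hlim x).const_mul _)
    · filter_upwards [self_mem_nhdsWithin] with δ hδ
      exact ((hT.sub measurable_id).mul
        (measurable_regField hs0 hs1 hδ hμ)).aestronglyMeasurable
    · filter_upwards [self_mem_nhdsWithin] with δ hδ
      refine Eventually.of_forall fun x => ?_
      rw [norm_mul]
      exact mul_le_mul_of_nonneg_left (hB δ hδ x) (abs_nonneg _)
  refine le_of_tendsto (l1.add (l2.const_mul 2)) ?_
  filter_upwards [self_mem_nhdsWithin] with δ hδ
  exact hle δ hδ

end

/-! ### Entropy and the Monge–Ampère equation on the line -/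

/-- The Lebesgue density of a measure on the line, as a real function. -/
noncomputable def lebesgueDensity (μ : Measure ℝ) (x : ℝ) : ℝ := (μ.rnDeriv volume x).toReal

lemma lebesgueDensity_nonneg (μ : Measure ℝ) (x : ℝ) : 0 ≤ lebesgueDensity μ x :=
  ENNReal.toReal_nonneg

lemma measurable_lebesgueDensity (μ : Measure ℝ) : Measurable (lebesgueDensity μ) :=
  (Measure.measurable_rnDeriv μ volume).ennreal_toReal

lemma lebesgueDensity_densityMeasure {ρ : ℝ → ℝ} (hρ0 : ∀ x, 0 ≤ ρ x) (hρm : Measurable ρ) :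
    lebesgueDensity (densityMeasure ρ) =ᵐ[volume] ρ := by
  filter_upwards [Measure.rnDeriv_withDensity volume hρm.ennreal_ofReal] with x hx
  rw [lebesgueDensity, densityMeasure, hx, ENNReal.toReal_ofReal (hρ0 x)]

section

variable {μ : Measure ℝ} [IsProbabilityMeasure μ]

lemma ae_hasDerivAt_cdf (μ : Measure ℝ) [IsProbabilityMeasure μ] :
    ∀ᵐ x, HasDerivAt (cdf μ) (lebesgueDensity μ x) x := by
  have := (cdf μ).ae_hasDerivAt
  rwa [measure_cdf] at this

lemma ae_lebesgueDensity_pos (hac : μ ≪ volume) : ∀ᵐ x ∂μ, 0 < lebesgueDensity μ x := by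
  filter_upwards [Measure.rnDeriv_pos hac, hac.ae_le (Measure.rnDeriv_lt_top μ volume)] with x h1 h2
  exact ENNReal.toReal_pos h1.ne' h2.ne

lemma ae_volume_of_ae (hac : μ ≪ volume) {p : ℝ → Prop} (h : ∀ᵐ x ∂μ, p x) :
    ∀ᵐ x, lebesgueDensity μ x ≠ 0 → p x := by
  rw [← Measure.withDensity_rnDeriv_eq μ volume hac,
    ae_withDensity_iff (Measure.measurable_rnDeriv μ volume)] at h
  filter_upwards [h] with x hx h0
  refine hx fun h1 => h0 ?_
  rw [lebesgueDensity, h1, ENNReal.toReal_zero]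

lemma integrable_lebesgueDensity_mul (hac : μ ≪ volume) {f : ℝ → ℝ} :
    Integrable (fun x => lebesgueDensity μ x * f x) volume ↔ Integrable f μ :=
  integrable_rnDeriv_smul_iff hac

lemma integral_lebesgueDensity_mul (hac : μ ≪ volume) (f : ℝ → ℝ) :
    ∫ x, lebesgueDensity μ x * f x = ∫ x, f x ∂μ :=
  integral_rnDeriv_smul hac

lemma entropy_eq_of_integrable (hac : μ ≪ volume)
    (hi : Integrable (fun x => Real.log (lebesgueDensity μ x)) μ) :
    entropy μ = ((∫ x, Real.log (lebesgueDensity μ x) ∂μ : ℝ) : EReal) := by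
  rw [entropy, if_pos ⟨hac, (integrable_lebesgueDensity_mul hac).2 hi⟩,
    ← integral_lebesgueDensity_mul hac]
  rfl

lemma integrable_log_of_entropy_ne_top (h : entropy μ ≠ ⊤) :
    μ ≪ volume ∧ Integrable (fun x => Real.log (lebesgueDensity μ x)) μ := by
  rw [entropy] at h
  split_ifs at h with hc
  · exact ⟨hc.1, (integrable_lebesgueDensity_mul hc.1).1 hc.2⟩
  · exact absurd rfl h

/-- A bounded density with finite second moment has finite entropy: the negative part of
`g log g` is controlled by comparison with a Gaussian. -/
lemma integrable_log_lebesgueDensity (hac : μ ≪ volume) {M : ℝ}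
    (hM : ∀ᵐ x ∂μ, lebesgueDensity μ x ≤ M) (h2 : Integrable (fun x : ℝ => x ^ 2) μ) :
    Integrable (fun x => Real.log (lebesgueDensity μ x)) μ := by
  rw [← integrable_lebesgueDensity_mul hac]
  have hg1 : Integrable (fun x => lebesgueDensity μ x * |Real.log M|) volume :=
    (integrable_lebesgueDensity_mul hac).2 (integrable_const _)
  have hg2 := (integrable_lebesgueDensity_mul hac).2 h2
  have hexp : Integrable (fun x : ℝ => Real.exp (-1 * x ^ 2)) volume :=
    integrable_exp_neg_mul_sq one_pos
  have hm := measurable_lebesgueDensity μ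
  refine Integrable.mono' ((hg1.add hexp).add hg2) (by fun_prop) ?_
  filter_upwards [ae_volume_of_ae hac hM] with x hx
  simp only [Pi.add_apply]
  set g := lebesgueDensity μ x with hgdef
  have hg0 : 0 ≤ g := lebesgueDensity_nonneg μ x
  rcases hg0.eq_or_lt with h0 | hpos
  · rw [← h0, zero_mul, zero_mul, zero_mul, norm_zero, zero_add, add_zero]
    exact (Real.exp_pos _).le
  · have hgM := hx hpos.ne'
    have hlog : Real.log g ≤ |Real.log M| := (Real.log_le_log hpos hgM).trans (le_abs_self _)
    have hE := Real.exp_pos (-1 * x ^ 2)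
    have hgauss : -(g * Real.log g) ≤ Real.exp (-1 * x ^ 2) + g * x ^ 2 := by
      have h1 := Real.log_le_sub_one_of_pos (div_pos hE hpos)
      rw [Real.log_div hE.ne' hpos.ne', Real.log_exp] at h1
      have h3 := mul_le_mul_of_nonneg_left h1 hpos.le
      rw [mul_sub g (Real.exp _ / g), mul_div_cancel₀ _ hpos.ne'] at h3
      linarith
    have hb1 := mul_le_mul_of_nonneg_left hlog hpos.le
    have hb2 : 0 ≤ g * |Real.log M| := by positivity
    have hb3 : 0 ≤ g * x ^ 2 := by positivity
    rw [Real.norm_eq_abs, abs_le]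
    constructor <;> linarith

end

lemma ae_differentiableAt_of_monotoneOn {T : ℝ → ℝ} {J : Set ℝ} (hJ : IsOpen J)
    (hT : MonotoneOn T J) : ∀ᵐ x, x ∈ J → DifferentiableAt ℝ T x := by
  filter_upwards [hT.ae_differentiableWithinAt_of_mem] with x hx hxJ
  exact (hx hxJ).differentiableAt (hJ.mem_nhds hxJ)

/-- The Monge–Ampère equation `g(T(x)) T'(x) = f(x)` for a map with `F_ν ∘ T = F_μ`, by
differentiating this identity. -/
lemma ae_mongeAmpere {μ ν : Measure ℝ} [IsProbabilityMeasure μ] [IsProbabilityMeasure ν]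
    (hμ : μ ≪ volume) (hν : ν ≪ volume) {T : ℝ → ℝ} (hTm : Measurable T) (hmap : μ.map T = ν)
    {J : Set ℝ} (hJo : IsOpen J) (hJ : ∀ᵐ x ∂μ, x ∈ J)
    (hTd : ∀ᵐ x ∂μ, DifferentiableAt ℝ T x) (hcdf : ∀ x ∈ J, cdf ν (T x) = cdf μ x) :
    ∀ᵐ x ∂μ, lebesgueDensity ν (T x) * deriv T x = lebesgueDensity μ x ∧
      0 < lebesgueDensity μ x ∧ 0 < lebesgueDensity ν (T x) ∧ 0 < deriv T x := by
  filter_upwards [hJ, hTd, hμ.ae_le (ae_hasDerivAt_cdf μ), ae_lebesgueDensity_pos hμ,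
    ae_comp_of_map_eq hTm hmap (hν.ae_le (ae_hasDerivAt_cdf ν)),
    ae_comp_of_map_eq hTm hmap (ae_lebesgueDensity_pos hν)] with x hxJ hd hF hpos hG hGpos
  have h1 : HasDerivAt (fun y => cdf ν (T y)) (lebesgueDensity ν (T x) * deriv T x) x :=
    HasDerivAt.comp (h₂ := cdf ν) x hG hd.hasDerivAt
  have h2 : HasDerivAt (fun y => cdf ν (T y)) (lebesgueDensity μ x) x := by
    refine hF.congr_of_eventuallyEq ?_
    filter_upwards [hJo.mem_nhds hxJ] with y hy
    exact hcdf y hy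
  have h3 := h1.unique h2
  refine ⟨h3, hpos, hGpos, ?_⟩
  rw [← h3] at hpos
  exact pos_of_mul_pos_right hpos hGpos.le

lemma ae_mongeAmpere_monotoneMap {μ ν : Measure ℝ} [IsProbabilityMeasure μ]
    [IsProbabilityMeasure ν] (hμ : μ ≪ volume) (hν : ν ≪ volume) :
    ∀ᵐ x ∂μ, lebesgueDensity ν (monotoneMap μ ν x) * deriv (monotoneMap μ ν) x
        = lebesgueDensity μ x ∧ 0 < lebesgueDensity μ x ∧
      0 < lebesgueDensity ν (monotoneMap μ ν x) ∧ 0 < deriv (monotoneMap μ ν) x := by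
  have := nullSingletonClass_of_absolutelyContinuous hμ
  have := nullSingletonClass_of_absolutelyContinuous hν
  refine ae_mongeAmpere hμ hν (measurable_monotoneMap μ ν) (map_monotoneMap μ ν)
    (isOpen_cdfSupport μ) (ae_mem_cdfSupport μ) ?_ fun x hx => cdf_monotoneMap hx
  filter_upwards [ae_mem_cdfSupport μ, hμ.ae_le (ae_differentiableAt_of_monotoneOn
    (isOpen_cdfSupport μ) (monotoneOn_monotoneMap μ ν))] with x h1 h2
  exact h2 h1

/-! ### Displacement interpolation -/

/-- The displacement interpolation map `(1 - t) T + t id` between the monotone map of `μ` onto `ν`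
(`t = 0`) and the identity (`t = 1`). -/
noncomputable def interpMap (μ ν : Measure ℝ) (t x : ℝ) : ℝ :=
  (1 - t) * monotoneMap μ ν x + t * x

lemma measurable_interpMap (μ ν : Measure ℝ) (t : ℝ) : Measurable (interpMap μ ν t) := by
  have := measurable_monotoneMap μ ν
  unfold interpMap
  fun_prop

lemma interpMap_sub_le {μ ν : Measure ℝ} {t x y : ℝ} (ht1 : t < 1)
    (hx : x ∈ cdfSupport μ) (hy : y ∈ cdfSupport μ) (hxy : x ≤ y) :
    t * (y - x) ≤ interpMap μ ν t y - interpMap μ ν t x := by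
  have := mul_le_mul_of_nonneg_left (monotoneOn_monotoneMap μ ν hx hy hxy)
    (sub_nonneg.2 ht1.le)
  unfold interpMap
  linarith

lemma strictMonoOn_interpMap {μ ν : Measure ℝ} {t : ℝ} (ht0 : 0 < t) (ht1 : t < 1) :
    StrictMonoOn (interpMap μ ν t) (cdfSupport μ) := by
  intro x hx y hy hxy
  have h1 := interpMap_sub_le (ν := ν) ht1 hx hy hxy.le
  have h2 := mul_pos ht0 (sub_pos.2 hxy)
  linarith

/-- The interpolation map expands distances by `t` at least, so that the interpolated measure is
absolutely continuous. -/
lemma map_interpMap_absolutelyContinuous {μ ν : Measure ℝ} [IsProbabilityMeasure μ]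
    (hμ : μ ≪ volume) {t : ℝ} (ht0 : 0 < t) (ht1 : t < 1) :
    μ.map (interpMap μ ν t) ≪ volume := by
  have := nullSingletonClass_of_absolutelyContinuous hμ
  set S := interpMap μ ν t with hS
  refine Measure.AbsolutelyContinuous.mk fun B hB hB0 => ?_
  rw [Measure.map_apply (measurable_interpMap μ ν t) hB]
  set J := cdfSupport μ with hJ
  have hinj : InjOn S J := (strictMonoOn_interpMap ht0 ht1).injOn
  have hlip : LipschitzOnWith (Real.toNNReal t⁻¹) (Function.invFunOn S J) (S '' J) := by
    refine LipschitzOnWith.of_dist_le_mul ?_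
    rintro _ ⟨x, hx, rfl⟩ _ ⟨y, hy, rfl⟩
    rw [hinj.leftInvOn_invFunOn hx, hinj.leftInvOn_invFunOn hy,
      Real.coe_toNNReal _ (inv_nonneg.2 ht0.le), Real.dist_eq, Real.dist_eq,
      inv_mul_eq_div, le_div_iff₀ ht0]
    rcases le_total x y with h | h
    · have h1 := interpMap_sub_le (ν := ν) ht1 hx hy h
      rw [abs_sub_comm, abs_of_nonneg (sub_nonneg.2 h), abs_sub_comm]
      refine le_trans ?_ (le_abs_self _)
      linarith
    · have h1 := interpMap_sub_le (ν := ν) ht1 hy hx h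
      rw [abs_of_nonneg (sub_nonneg.2 h)]
      refine le_trans ?_ (le_abs_self _)
      linarith
  have himg : S ⁻¹' B ∩ J ⊆ Function.invFunOn S J '' (B ∩ S '' J) := by
    rintro x ⟨hxB, hxJ⟩
    exact ⟨S x, ⟨hxB, mem_image_of_mem S hxJ⟩, hinj.leftInvOn_invFunOn hxJ⟩
  have hnull : volume (S ⁻¹' B ∩ J) = 0 := by
    refine measure_mono_null himg ?_
    have h1 := (hlip.mono inter_subset_right).hausdorffMeasure_image_le (d := 1) zero_le_one
      (s := B ∩ S '' J)
    rw [hausdorffMeasure_real, measure_mono_null inter_subset_left hB0, mul_zero] at h1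
    exact le_antisymm h1 zero_le
  have h2 : μ (S ⁻¹' B ∩ J) = 0 := hμ hnull
  rw [← h2]
  refine measure_congr ?_
  filter_upwards [ae_mem_cdfSupport μ] with x hx
  exact propext ⟨fun h => ⟨h, hx⟩, fun h => h.1⟩

lemma cdf_map_interpMap {μ ν : Measure ℝ} [IsProbabilityMeasure μ] [NullSingletonClass μ]
    {t x : ℝ} (ht0 : 0 < t) (ht1 : t < 1) (hx : x ∈ cdfSupport μ) :
    cdf (μ.map (interpMap μ ν t)) (interpMap μ ν t x) = cdf μ x := by
  have hm := measurable_interpMap μ ν t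
  have : IsProbabilityMeasure (μ.map (interpMap μ ν t)) :=
    Measure.isProbabilityMeasure_map hm.aemeasurable
  rw [cdf_eq_real, cdf_eq_real, measureReal_def, measureReal_def,
    Measure.map_apply hm measurableSet_Iic]
  congr 1
  refine measure_congr ?_
  filter_upwards [ae_mem_cdfSupport μ] with y hy
  exact propext ((strictMonoOn_interpMap ht0 ht1).le_iff_le hy hx)

/-- Convexity of the entropy along the displacement interpolation. -/
lemma entropy_interp_le {μ ν : Measure ℝ} [IsProbabilityMeasure μ] [IsProbabilityMeasure ν]
    (hμ : μ ≪ volume) (hν : ν ≪ volume) {M : ℝ} (hM : ∀ᵐ x ∂μ, lebesgueDensity μ x ≤ M)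
    (hμi : Integrable (fun x => Real.log (lebesgueDensity μ x)) μ)
    (hνi : Integrable (fun x => Real.log (lebesgueDensity ν x)) ν) {t : ℝ} (ht0 : 0 < t)
    (ht1 : t < 1) (h2 : Integrable (fun x : ℝ => x ^ 2) (μ.map (interpMap μ ν t))) :
    Integrable (fun x => Real.log (lebesgueDensity (μ.map (interpMap μ ν t)) x))
        (μ.map (interpMap μ ν t)) ∧
      ∫ x, Real.log (lebesgueDensity (μ.map (interpMap μ ν t)) x) ∂(μ.map (interpMap μ ν t))
        ≤ (1 - t) * ∫ x, Real.log (lebesgueDensity ν x) ∂ν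
          + t * ∫ x, Real.log (lebesgueDensity μ x) ∂μ := by
  have := nullSingletonClass_of_absolutelyContinuous hμ
  have hTm := measurable_monotoneMap μ ν
  have hmapT := map_monotoneMap μ ν
  have hSm := measurable_interpMap μ ν t
  have hac : μ.map (interpMap μ ν t) ≪ volume := map_interpMap_absolutelyContinuous hμ ht0 ht1
  have : IsProbabilityMeasure (μ.map (interpMap μ ν t)) :=
    Measure.isProbabilityMeasure_map hSm.aemeasurable
  have hTd : ∀ᵐ x ∂μ, DifferentiableAt ℝ (monotoneMap μ ν) x := by
    filter_upwards [ae_mem_cdfSupport μ, hμ.ae_le (ae_differentiableAt_of_monotoneOn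
      (isOpen_cdfSupport μ) (monotoneOn_monotoneMap μ ν))] with x h1 h2
    exact h2 h1
  have hSd : ∀ᵐ x ∂μ,
      HasDerivAt (interpMap μ ν t) ((1 - t) * deriv (monotoneMap μ ν) x + t * 1) x := by
    filter_upwards [hTd] with x hx
    exact (hx.hasDerivAt.const_mul (1 - t)).add ((hasDerivAt_id x).const_mul t)
  have hMS := ae_mongeAmpere hμ hac hSm rfl (isOpen_cdfSupport μ) (ae_mem_cdfSupport μ)
    (hSd.mono fun x hx => hx.differentiableAt) fun x hx => cdf_map_interpMap ht0 ht1 hx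
  have hMT := ae_mongeAmpere_monotoneMap hμ hν
  set μt := μ.map (interpMap μ ν t) with hμt
  have hbdd : ∀ᵐ x ∂μt, lebesgueDensity μt x ≤ M / t := by
    rw [hμt, ae_map_iff hSm.aemeasurable
      (measurableSet_le (measurable_lebesgueDensity _) measurable_const)]
    filter_upwards [hMS, hMT, hSd, hM] with x h1 h2 h3 h4
    rw [h3.deriv] at h1
    rw [le_div_iff₀ ht0]
    have h5 : 0 ≤ lebesgueDensity μt (interpMap μ ν t x) * ((1 - t) * deriv (monotoneMap μ ν) x) :=
      mul_nonneg h1.2.2.1.le (mul_nonneg (by linarith) h2.2.2.2.le)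
    have h6 := h1.1
    rw [← hμt]
    rw [mul_add, mul_one] at h6
    linarith
  have hti := integrable_log_lebesgueDensity hac hbdd h2
  refine ⟨hti, ?_⟩
  have hi1 := integrable_comp_of_map_eq hTm hmapT hνi
  rw [← integral_comp_of_map_eq hSm rfl hti.1, ← integral_comp_of_map_eq hTm hmapT hνi.1,
    ← integral_const_mul, ← integral_const_mul,
    ← integral_add (hi1.const_mul _) (hμi.const_mul _)]
  refine integral_mono_ae (integrable_comp_of_map_eq hSm rfl hti)
    ((hi1.const_mul _).add (hμi.const_mul _)) ?_
  filter_upwards [hMS, hMT, hSd] with x h1 h2 h3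
  obtain ⟨a1, a2, a3, a4⟩ := h1
  obtain ⟨b1, b2, b3, b4⟩ := h2
  rw [h3.deriv] at a1 a4
  have c1 : Real.log (lebesgueDensity μt (interpMap μ ν t x))
      = Real.log (lebesgueDensity μ x)
        - Real.log ((1 - t) * deriv (monotoneMap μ ν) x + t * 1) := by
    rw [← a1, Real.log_mul a3.ne' a4.ne']
    ring
  have c2 : Real.log (lebesgueDensity ν (monotoneMap μ ν x))
      = Real.log (lebesgueDensity μ x) - Real.log (deriv (monotoneMap μ ν) x) := by
    rw [← b1, Real.log_mul b3.ne' b4.ne']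
    ring
  have c3 := strictConcaveOn_log_Ioi.concaveOn.2 (mem_Ioi.2 b4) (mem_Ioi.2 one_pos)
    (sub_nonneg.2 ht1.le) ht0.le (sub_add_cancel 1 t)
  simp only [smul_eq_mul, Real.log_one, mul_zero, add_zero] at c3
  rw [c1, c2]
  linarith

/-! ### Integration by parts against a monotone function -/

section

variable {ρ : ℝ → ℝ}

lemma tendsto_zero_of_absolutelyContinuous (hρ1 : Integrable ρ volume)
    (hac : ∀ a b : ℝ, AbsolutelyContinuousOnInterval ρ a b)
    (hρ' : Integrable (deriv ρ) volume) :
    Tendsto ρ atTop (𝓝 0) ∧ Tendsto ρ atBot (𝓝 0) := by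
  constructor
  · have h1 := (intervalIntegral_tendsto_integral_Ioi 0 hρ'.integrableOn tendsto_id).const_add
      (ρ 0)
    have h2 : ∀ x, ρ 0 + ∫ t in (0 : ℝ)..(id x), deriv ρ t = ρ x := fun x => by
      rw [(hac 0 (id x)).integral_deriv_eq_sub]
      simp
    simp only [h2] at h1
    have h3 := IntegrableAtFilter.eq_zero_of_tendsto (hρ1.integrableAtFilter atTop) (fun s hs => by
      obtain ⟨a, ha⟩ := mem_atTop_sets.1 hs
      exact measure_mono_top (fun y hy => ha y hy) (Real.volume_Ici (a := a))) h1
    rwa [h3] at h1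
  · have h1 := (intervalIntegral_tendsto_integral_Iic 0 hρ'.integrableOn tendsto_id).const_sub
      (ρ 0)
    have h2 : ∀ x, ρ 0 - ∫ t in (id x)..(0 : ℝ), deriv ρ t = ρ x := fun x => by
      rw [(hac (id x) 0).integral_deriv_eq_sub]
      simp
    simp only [h2] at h1
    have h3 := IntegrableAtFilter.eq_zero_of_tendsto (hρ1.integrableAtFilter atBot) (fun s hs => by
      obtain ⟨a, ha⟩ := mem_atBot_sets.1 hs
      exact measure_mono_top (fun y hy => ha y hy) (Real.volume_Iic (a := a))) h1
    rwa [h3] at h1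

/-- Integration by parts on the whole line for an absolutely continuous integrable function and a
bounded function with bounded derivative. -/
lemma integral_mul_deriv_eq_neg (hρ1 : Integrable ρ volume)
    (hac : ∀ a b : ℝ, AbsolutelyContinuousOnInterval ρ a b)
    (hρ' : Integrable (deriv ρ) volume) {g : ℝ → ℝ} {K : ℝ} (hgm : Measurable g)
    (hgb : ∀ x, |g x| ≤ K) (hgac : ∀ a b : ℝ, AbsolutelyContinuousOnInterval g a b)
    (hg' : Integrable (fun x => ρ x * deriv g x) volume) :
    ∫ x, ρ x * deriv g x = -∫ x, deriv ρ x * g x := by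
  obtain ⟨hT, hB⟩ := tendsto_zero_of_absolutelyContinuous hρ1 hac hρ'
  have i2 : Integrable (fun x => deriv ρ x * g x) volume :=
    hρ'.mul_bdd hgm.aestronglyMeasurable (Eventually.of_forall hgb)
  have hz : ∀ {l : Filter ℝ}, Tendsto ρ l (𝓝 0) → Tendsto (fun x => ρ x * g x) l (𝓝 0) := by
    intro l hl
    have h1 : Tendsto (fun x => |ρ x| * K) l (𝓝 0) := by
      simpa using hl.abs.mul_const K
    refine squeeze_zero_norm (fun x => ?_) h1
    rw [norm_mul]
    exact mul_le_mul_of_nonneg_left (hgb x) (abs_nonneg _)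
  have l1 := intervalIntegral_tendsto_integral hg' tendsto_neg_atTop_atBot tendsto_id
  have l2 := intervalIntegral_tendsto_integral i2 tendsto_neg_atTop_atBot tendsto_id
  have l3 := (((hz hT).sub ((hz hB).comp tendsto_neg_atTop_atBot)).sub l2)
  rw [sub_zero, zero_sub] at l3
  refine tendsto_nhds_unique l1 (l3.congr fun x => ?_)
  exact ((hac (-x) x).integral_mul_deriv_eq_deriv_mul (hgac (-x) x)).symm

/-- Integration by parts against a bounded monotone function `S`. Only the absolutely continuous
part of the Stieltjes measure `dS` is kept, whence the inequality. The function `S` is approximated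
by its averages `h⁻¹ ∫ S` over `[x, x + h]`. -/
lemma lintegral_mul_deriv_le_of_monotone (hρ0 : ∀ x, 0 ≤ ρ x) (hρc : Continuous ρ)
    (hρ1 : Integrable ρ volume)
    (hac : ∀ a b : ℝ, AbsolutelyContinuousOnInterval ρ a b)
    (hρ' : Integrable (deriv ρ) volume) {S : ℝ → ℝ} (hS : Monotone S) {K : ℝ}
    (hK : ∀ x, |S x| ≤ K) :
    0 ≤ -∫ x, deriv ρ x * S x ∧
      ∫⁻ x, ENNReal.ofReal (ρ x * deriv S x) ≤ ENNReal.ofReal (-∫ x, deriv ρ x * S x) := by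
  have hK0 : 0 ≤ K := (abs_nonneg _).trans (hK 0)
  have hSm : Measurable S := hS.measurable
  have hSi : ∀ a b, IntervalIntegrable S volume a b := fun a b => hS.intervalIntegrable
  set V : ℝ → ℝ := fun x => ∫ t in (0 : ℝ)..x, S t with hV
  have hVsub : ∀ x y, V x - V y = ∫ t in y..x, S t := fun x y =>
    intervalIntegral.integral_interval_sub_left (hSi 0 x) (hSi 0 y)
  have hVlip : ∀ x y, |V x - V y| ≤ K * |x - y| := fun x y => by
    rw [hVsub]
    exact intervalIntegral.norm_integral_le_of_norm_le_const (f := S) fun t _ => hK t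
  have hVc : Continuous V :=
    (LipschitzWith.of_dist_le_mul (K := Real.toNNReal K) fun x y => by
      rw [Real.coe_toNNReal _ hK0]
      exact hVlip x y).continuous
  have hVd : ∀ᵐ x, HasDerivAt V (S x) x := by
    filter_upwards [_root_.LocallyIntegrable.ae_hasDerivAt_integral hS.locallyIntegrable]
      with x hx
    exact hx 0
  set Vh : ℝ → ℝ → ℝ := fun h x => h⁻¹ * (V (x + h) - V x) with hVh
  set D : ℝ → ℝ → ℝ := fun h x => h⁻¹ * (S (x + h) - S x) with hD
  have hVhb : ∀ h, 0 < h → ∀ x, |Vh h x| ≤ K := by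
    intro h hh x
    have := hVlip (x + h) x
    rw [add_sub_cancel_left, abs_of_pos hh] at this
    rw [hVh, abs_mul, abs_of_pos (inv_pos.2 hh), inv_mul_eq_div, div_le_iff₀ hh]
    exact this
  have hVhac : ∀ h, 0 < h → ∀ a b, AbsolutelyContinuousOnInterval (Vh h) a b := by
    intro h hh a b
    refine LipschitzOnWith.absolutelyContinuousOnInterval (K := Real.toNNReal (h⁻¹ * (2 * K)))
      (LipschitzOnWith.of_dist_le_mul fun x _ y _ => ?_)
    have hi := inv_pos.2 hh
    rw [Real.coe_toNNReal _ (by positivity), Real.dist_eq, Real.dist_eq]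
    have e : Vh h x - Vh h y = h⁻¹ * ((V (x + h) - V (y + h)) - (V x - V y)) := by
      rw [hVh]
      ring
    have h1 := hVlip (x + h) (y + h)
    rw [add_sub_add_right_eq_sub] at h1
    have h2 := hVlip x y
    rw [e, abs_mul, abs_of_pos hi, mul_assoc]
    refine mul_le_mul_of_nonneg_left ?_ hi.le
    refine (abs_sub _ _).trans ?_
    linarith
  have hVhd : ∀ h, ∀ᵐ x, deriv (Vh h) x = D h x := by
    intro h
    filter_upwards [hVd, (measurePreserving_add_right volume h).quasiMeasurePreserving.ae hVd]
      with x h1 h2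
    exact (((h2.comp_add_const x h).sub h1).const_mul h⁻¹).deriv
  have hDm : ∀ h, Measurable (D h) := fun h => by
    have := hSm.comp (measurable_id.add_const h)
    exact (this.sub hSm).const_mul _
  have hDi : ∀ h, Integrable (fun x => ρ x * D h x) volume := by
    intro h
    refine hρ1.mul_bdd (c := |h⁻¹| * (2 * K)) (hDm h).aestronglyMeasurable
      (Eventually.of_forall fun x => ?_)
    rw [hD, norm_mul]
    refine mul_le_mul_of_nonneg_left ?_ (abs_nonneg _)
    refine (abs_sub _ _).trans ?_
    linarith [hK (x + h), hK x]
  have hD0 : ∀ h, 0 < h → ∀ x, 0 ≤ ρ x * D h x := fun h hh x =>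
    mul_nonneg (hρ0 x) (mul_nonneg (inv_pos.2 hh).le
      (sub_nonneg.2 (hS (le_add_of_nonneg_right hh.le))))
  have hibp : ∀ h, 0 < h → ∫ x, ρ x * D h x = -∫ x, deriv ρ x * Vh h x := by
    intro h hh
    have e : (fun x => ρ x * D h x) =ᵐ[volume] fun x => ρ x * deriv (Vh h) x := by
      filter_upwards [hVhd h] with x hx
      rw [hx]
    rw [integral_congr_ae e]
    refine integral_mul_deriv_eq_neg hρ1 hac hρ' ?_ (hVhb h hh) (hVhac h hh) ((hDi h).congr e)
    have : Continuous (Vh h) := by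
      rw [hVh]
      fun_prop
    exact this.measurable
  have hlim : Tendsto (fun h => -∫ x, deriv ρ x * Vh h x) (𝓝[>] 0)
      (𝓝 (-∫ x, deriv ρ x * S x)) := by
    refine Tendsto.neg (tendsto_integral_filter_of_dominated_convergence
      (F := fun h x => deriv ρ x * Vh h x) (fun x => |deriv ρ x| * K) ?_ ?_
      (hρ'.abs.mul_const K) ?_)
    · refine Eventually.of_forall fun h => ?_
      have : Continuous (Vh h) := by
        rw [hVh]
        fun_prop
      exact hρ'.1.mul this.aestronglyMeasurable
    · filter_upwards [self_mem_nhdsWithin] with h hh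
      refine Eventually.of_forall fun x => ?_
      rw [norm_mul]
      exact mul_le_mul_of_nonneg_left (hVhb h hh x) (abs_nonneg _)
    · filter_upwards [hVd] with x hx
      exact (hx.tendsto_slope_zero_right).const_mul _
  have hlim2 : Tendsto (fun h => ∫ x, ρ x * D h x) (𝓝[>] 0) (𝓝 (-∫ x, deriv ρ x * S x)) := by
    refine hlim.congr' ?_
    filter_upwards [self_mem_nhdsWithin] with h hh
    exact (hibp h hh).symm
  constructor
  · refine ge_of_tendsto hlim2 ?_
    filter_upwards [self_mem_nhdsWithin] with h hh
    exact integral_nonneg (hD0 h hh)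
  · have hlim3 : Tendsto (fun h => ∫⁻ x, ENNReal.ofReal (ρ x * D h x)) (𝓝[>] 0)
        (𝓝 (ENNReal.ofReal (-∫ x, deriv ρ x * S x))) := by
      refine (ENNReal.tendsto_ofReal hlim2).congr' ?_
      filter_upwards [self_mem_nhdsWithin] with h hh
      exact ofReal_integral_eq_lintegral_ofReal (hDi h) (Eventually.of_forall (hD0 h hh))
    rw [← hlim3.liminf_eq]
    refine le_trans (lintegral_mono_ae ?_) (lintegral_liminf_le fun h =>
      (hρc.measurable.mul (hDm h)).ennreal_ofReal)
    filter_upwards [hS.ae_differentiableAt] with x hx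
    have : Tendsto (fun h => ENNReal.ofReal (ρ x * D h x)) (𝓝[>] 0)
        (𝓝 (ENNReal.ofReal (ρ x * deriv S x))) :=
      ENNReal.tendsto_ofReal ((hx.hasDerivAt.tendsto_slope_zero_right).const_mul _)
    rw [this.liminf_eq]

lemma neg_integral_deriv_mul_id_le (hρ0 : ∀ x, 0 ≤ ρ x) (hρ1 : Integrable ρ volume)
    (hac : ∀ a b : ℝ, AbsolutelyContinuousOnInterval ρ a b)
    (hi : Integrable (fun x => deriv ρ x * x) volume) :
    -∫ x, deriv ρ x * x ≤ ∫ x, ρ x := by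
  have l1 := intervalIntegral_tendsto_integral hρ1 tendsto_neg_atTop_atBot tendsto_id
  have l2 := intervalIntegral_tendsto_integral hi tendsto_neg_atTop_atBot tendsto_id
  refine le_of_tendsto_of_tendsto l2.neg l1 ?_
  filter_upwards [eventually_ge_atTop (0 : ℝ)] with x hx
  have hid : AbsolutelyContinuousOnInterval (fun x : ℝ => x) (-x) x :=
    LipschitzOnWith.absolutelyContinuousOnInterval (K := 1) LipschitzWith.id.lipschitzOnWith
  have := (hac (-x) x).integral_mul_deriv_eq_deriv_mul hid
  simp only [deriv_id'', mul_one] at this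
  have h1 := mul_nonneg (hρ0 x) hx
  have h2 := mul_nonneg (hρ0 (-x)) hx
  simp only [id]
  linarith

end

/-! ### Tangent inequality for the entropy -/

/-- The logarithmic derivative of a density. -/
noncomputable def score (ρ : ℝ → ℝ) : ℝ → ℝ := deriv fun y => Real.log (ρ y)

lemma measurable_score (ρ : ℝ → ℝ) : Measurable (score ρ) := measurable_deriv _

lemma ae_differentiableAt_of_absolutelyContinuous {ρ : ℝ → ℝ}
    (hac : ∀ a b : ℝ, AbsolutelyContinuousOnInterval ρ a b) :
    ∀ᵐ x, DifferentiableAt ℝ ρ x := by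
  have h : ∀ᵐ x, ∀ n : ℕ, x ∈ uIcc (-(n : ℝ)) n → DifferentiableAt ℝ ρ x :=
    ae_all_iff.2 fun n => (hac (-(n : ℝ)) n).ae_differentiableAt
  filter_upwards [h] with x hx
  obtain ⟨n, hn⟩ := exists_nat_ge |x|
  exact hx n (Icc_subset_uIcc (abs_le.1 hn))

lemma deriv_eq_zero_of_eq_zero {ρ : ℝ → ℝ} (hρ0 : ∀ x, 0 ≤ ρ x) {x : ℝ} (hx : ρ x = 0) :
    deriv ρ x = 0 :=
  IsLocalMin.deriv_eq_zero (Eventually.of_forall fun y => by rw [hx]; exact hρ0 y)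

lemma ae_deriv_eq_mul_score {ρ : ℝ → ℝ} (hρ0 : ∀ x, 0 ≤ ρ x)
    (hac : ∀ a b : ℝ, AbsolutelyContinuousOnInterval ρ a b) :
    ∀ᵐ x, deriv ρ x = ρ x * score ρ x := by
  filter_upwards [ae_differentiableAt_of_absolutelyContinuous hac] with x hx
  by_cases h : ρ x = 0
  · rw [h, zero_mul, deriv_eq_zero_of_eq_zero hρ0 h]
  · rw [score, deriv.log hx h, mul_div_cancel₀ _ h]

/-- The monotone map truncated to `[-k, k]`, extended to a monotone function on the whole line. -/
noncomputable def clampMap (μ ν : Measure ℝ) (k x : ℝ) : ℝ :=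
  if cdf μ x ≤ 0 then -k else if 1 ≤ cdf μ x then k else max (-k) (min k (monotoneMap μ ν x))

lemma abs_clampMap_le (μ ν : Measure ℝ) {k : ℝ} (hk : 0 ≤ k) (x : ℝ) :
    |clampMap μ ν k x| ≤ k := by
  have h : -k ≤ k := by linarith
  unfold clampMap
  split_ifs
  · rw [abs_neg, abs_of_nonneg hk]
  · rw [abs_of_nonneg hk]
  · exact abs_le.2 ⟨le_max_left _ _, max_le h (min_le_left _ _)⟩

lemma clampMap_of_mem {μ ν : Measure ℝ} {k x : ℝ} (hx : x ∈ cdfSupport μ) :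
    clampMap μ ν k x = max (-k) (min k (monotoneMap μ ν x)) := by
  rw [clampMap, if_neg (not_le.2 hx.1), if_neg (not_le.2 hx.2)]

lemma clampMap_eq_of_abs_le {μ ν : Measure ℝ} {k x : ℝ} (hx : x ∈ cdfSupport μ)
    (hk : |monotoneMap μ ν x| ≤ k) : clampMap μ ν k x = monotoneMap μ ν x := by
  obtain ⟨h1, h2⟩ := abs_le.1 hk
  rw [clampMap_of_mem hx, min_eq_right h2, max_eq_right h1]

lemma abs_clampMap_le_abs {μ ν : Measure ℝ} {k x : ℝ} (hk : 0 ≤ k) (hx : x ∈ cdfSupport μ) :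
    |clampMap μ ν k x| ≤ |monotoneMap μ ν x| := by
  rcases le_total |monotoneMap μ ν x| k with h | h
  · rw [clampMap_eq_of_abs_le hx h]
  · exact (abs_clampMap_le μ ν hk x).trans h

lemma monotone_clampMap (μ ν : Measure ℝ) {k : ℝ} (hk : 0 ≤ k) : Monotone (clampMap μ ν k) := by
  intro x y hxy
  have hF := monotone_cdf μ hxy
  have hy := abs_le.1 (abs_clampMap_le μ ν hk y)
  have hx := abs_le.1 (abs_clampMap_le μ ν hk x)
  by_cases h1 : cdf μ x ≤ 0
  · rw [clampMap, if_pos h1]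
    exact hy.1
  · by_cases h2 : 1 ≤ cdf μ y
    · have h3 : ¬cdf μ y ≤ 0 := fun h => by linarith
      rw [clampMap, clampMap, if_neg h3, if_pos h2]
      exact hx.2
    · have hxJ : x ∈ cdfSupport μ := ⟨not_le.1 h1, by linarith [not_le.1 h2]⟩
      have hyJ : y ∈ cdfSupport μ := ⟨by linarith [not_le.1 h1], not_le.1 h2⟩
      rw [clampMap_of_mem hxJ, clampMap_of_mem hyJ]
      exact max_le_max le_rfl (min_le_min le_rfl (monotoneOn_monotoneMap μ ν hxJ hyJ hxy))

/-- Near a point of continuity the truncation is not active for large `k`. -/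
lemma eventually_clampMap_eq {μ ν : Measure ℝ} [IsProbabilityMeasure μ] [NullSingletonClass μ]
    {x : ℝ} (hx : x ∈ cdfSupport μ) (hc : ContinuousAt (monotoneMap μ ν) x) :
    ∀ᶠ k : ℕ in atTop, clampMap μ ν k =ᶠ[𝓝 x] monotoneMap μ ν := by
  obtain ⟨n, hn⟩ := exists_nat_gt |monotoneMap μ ν x|
  filter_upwards [eventually_ge_atTop n] with k hk
  filter_upwards [(isOpen_cdfSupport μ).mem_nhds hx, hc.abs.eventually (gt_mem_nhds hn)]
    with y hy1 hy2
  exact clampMap_eq_of_abs_le hy1 (hy2.le.trans (Nat.cast_le.2 hk))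

section

variable {ρ : ℝ → ℝ} (hρ0 : ∀ x, 0 ≤ ρ x) (hρc : Continuous ρ) (hρ1 : Integrable ρ volume)
  (hmass : ∫ x, ρ x = 1) (hac : ∀ a b : ℝ, AbsolutelyContinuousOnInterval ρ a b)
  (hL : Integrable (fun x => score ρ x ^ 2) (densityMeasure ρ))

include hρ0 hρc hρ1 hmass hac hL

/-- The inequality `∫ T' dμ ≤ -∫ (log ρ)' T dμ` for the monotone map `T`, by truncating `T`. -/
lemma integral_deriv_monotoneMap_le {ν : Measure ℝ} [IsProbabilityMeasure ν] (hν : ν ≪ volume)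
    (h2ν : Integrable (fun x : ℝ => x ^ 2) ν) :
    Integrable (deriv (monotoneMap (densityMeasure ρ) ν)) (densityMeasure ρ) ∧
    ∫ x, deriv (monotoneMap (densityMeasure ρ) ν) x ∂(densityMeasure ρ)
      ≤ -∫ x, score ρ x * monotoneMap (densityMeasure ρ) ν x ∂(densityMeasure ρ) := by
  set μ := densityMeasure ρ with hμdef
  have : IsProbabilityMeasure μ := isProbabilityMeasure_densityMeasure hρ0 hρ1 hmass
  have hμac : μ ≪ volume := densityMeasure_absolutelyContinuous ρ
  have : NullSingletonClass μ := nullSingletonClass_of_absolutelyContinuous hμac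
  have hρm := hρc.measurable
  set T := monotoneMap μ ν with hT
  have hTm : Measurable T := measurable_monotoneMap μ ν
  have hscore := ae_deriv_eq_mul_score hρ0 hac
  have hsc1 : Integrable (score ρ) μ :=
    integrable_of_integrable_sq (measurable_score ρ).aestronglyMeasurable hL
  have hρ' : Integrable (deriv ρ) volume := by
    refine ((integrable_densityMeasure hρ0 hρm).1 hsc1).congr ?_
    filter_upwards [hscore] with x hx
    exact hx.symm
  have hLT : Integrable (fun x => score ρ x * T x) μ :=
    integrable_mul_of_integrable_sq (measurable_score ρ).aestronglyMeasurable
      hTm.aestronglyMeasurable hL (integrable_monotoneMap_sq h2ν)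
  have heLT : (fun x => deriv ρ x * T x) =ᵐ[volume] fun x => ρ x * (score ρ x * T x) := by
    filter_upwards [hscore] with x hx
    rw [hx, mul_assoc]
  have hρ'T : Integrable (fun x => deriv ρ x * T x) volume :=
    ((integrable_densityMeasure hρ0 hρm).1 hLT).congr heLT.symm
  have hdens : ∀ {p : ℝ → Prop}, (∀ᵐ x ∂μ, p x) → ∀ᵐ x, ρ x ≠ 0 → p x := by
    intro p hp
    rw [hμdef, densityMeasure, ae_withDensity_iff hρm.ennreal_ofReal] at hp
    filter_upwards [hp] with x hx h0
    refine hx fun h1 => h0 ?_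
    exact le_antisymm (ENNReal.ofReal_eq_zero.1 h1) (hρ0 x)
  have hJ := hdens (ae_mem_cdfSupport μ)
  have hd := ae_differentiableAt_of_monotoneOn (isOpen_cdfSupport μ) (monotoneOn_monotoneMap μ ν)
  have hTk : ∀ k : ℕ, 0 ≤ -∫ x, deriv ρ x * clampMap μ ν k x ∧
      ∫⁻ x, ENNReal.ofReal (ρ x * deriv (clampMap μ ν k) x)
        ≤ ENNReal.ofReal (-∫ x, deriv ρ x * clampMap μ ν k x) := fun k =>
    lintegral_mul_deriv_le_of_monotone hρ0 hρc hρ1 hac hρ'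
      (monotone_clampMap μ ν (Nat.cast_nonneg k)) (abs_clampMap_le μ ν (Nat.cast_nonneg k))
  have hlim : Tendsto (fun k : ℕ => -∫ x, deriv ρ x * clampMap μ ν k x) atTop
      (𝓝 (-∫ x, deriv ρ x * T x)) := by
    refine Tendsto.neg (tendsto_integral_of_dominated_convergence
      (fun x => ‖deriv ρ x * T x‖) (fun k => ?_) hρ'T.norm (fun k => ?_) ?_)
    · exact hρ'.1.mul (monotone_clampMap μ ν (Nat.cast_nonneg k)).measurable.aestronglyMeasurable
    · filter_upwards [hJ] with x hx
      by_cases h0 : ρ x = 0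
      · rw [deriv_eq_zero_of_eq_zero hρ0 h0, zero_mul, zero_mul]
      · rw [norm_mul, norm_mul]
        exact mul_le_mul_of_nonneg_left (abs_clampMap_le_abs (Nat.cast_nonneg k) (hx h0))
          (norm_nonneg _)
    · filter_upwards [hJ, hd] with x hx hxd
      by_cases h0 : ρ x = 0
      · simp only [deriv_eq_zero_of_eq_zero hρ0 h0, zero_mul]
        exact tendsto_const_nhds
      · refine tendsto_const_nhds.congr' ?_
        filter_upwards [eventually_clampMap_eq (hx h0) (hxd (hx h0)).continuousAt] with k hk
        rw [hk.eq_of_nhds]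
  have h0le : 0 ≤ -∫ x, deriv ρ x * T x := ge_of_tendsto' hlim fun k => (hTk k).1
  have hfatou : ∫⁻ x, ENNReal.ofReal (ρ x * deriv T x)
      ≤ ENNReal.ofReal (-∫ x, deriv ρ x * T x) := by
    rw [← (ENNReal.tendsto_ofReal hlim).liminf_eq]
    refine le_trans ?_ (liminf_le_liminf (Eventually.of_forall fun k => (hTk k).2))
    refine le_trans (lintegral_mono_ae ?_) (lintegral_liminf_le fun k =>
      (hρm.mul (measurable_deriv _)).ennreal_ofReal)
    filter_upwards [hJ, hd] with x hx hxd
    have : Tendsto (fun k : ℕ => ENNReal.ofReal (ρ x * deriv (clampMap μ ν k) x)) atTop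
        (𝓝 (ENNReal.ofReal (ρ x * deriv T x))) := by
      refine tendsto_const_nhds.congr' ?_
      by_cases h0 : ρ x = 0
      · simp only [h0, zero_mul, EventuallyEq.refl]
      · filter_upwards [eventually_clampMap_eq (hx h0) (hxd (hx h0)).continuousAt] with k hk
        rw [hk.deriv_eq]
    rw [this.liminf_eq]
  have hpos : ∀ᵐ x, 0 ≤ ρ x * deriv T x := by
    filter_upwards [hdens (ae_mongeAmpere_monotoneMap hμac hν)] with x hx
    by_cases h0 : ρ x = 0
    · rw [h0, zero_mul]
    · exact mul_nonneg (hρ0 x) (hx h0).2.2.2.le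
  have hmeas : AEStronglyMeasurable (fun x => ρ x * deriv T x) volume :=
    (hρm.mul (measurable_deriv _)).aestronglyMeasurable
  have hint : Integrable (fun x => ρ x * deriv T x) volume :=
    ⟨hmeas, (hasFiniteIntegral_iff_ofReal hpos).2 (hfatou.trans_lt ENNReal.ofReal_lt_top)⟩
  refine ⟨(integrable_densityMeasure hρ0 hρm).2 hint, ?_⟩
  rw [integral_densityMeasure hρ0 hρm, integral_densityMeasure hρ0 hρm,
    ← integral_congr_ae heLT, integral_eq_lintegral_of_nonneg_ae hpos hmeas]
  exact ENNReal.toReal_le_of_le_ofReal h0le hfatou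

/-- Displacement convexity of the entropy, in the form of a tangent inequality at a density with
finite Fisher information. -/
lemma entropy_tangent_le {ν : Measure ℝ} [IsProbabilityMeasure ν] (hν : ν ≪ volume)
    (h2μ : Integrable (fun x : ℝ => x ^ 2) (densityMeasure ρ))
    (h2ν : Integrable (fun x : ℝ => x ^ 2) ν)
    (hμi : Integrable (fun x => Real.log (lebesgueDensity (densityMeasure ρ) x))
      (densityMeasure ρ))
    (hνi : Integrable (fun x => Real.log (lebesgueDensity ν x)) ν) :
    ∫ x, Real.log (lebesgueDensity (densityMeasure ρ) x) ∂(densityMeasure ρ)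
        + ∫ x, score ρ x * (monotoneMap (densityMeasure ρ) ν x - x) ∂(densityMeasure ρ)
      ≤ ∫ x, Real.log (lebesgueDensity ν x) ∂ν := by
  obtain ⟨hdi, hdle⟩ := integral_deriv_monotoneMap_le hρ0 hρc hρ1 hmass hac hL hν h2ν
  set μ := densityMeasure ρ with hμdef
  have : IsProbabilityMeasure μ := isProbabilityMeasure_densityMeasure hρ0 hρ1 hmass
  have hμac : μ ≪ volume := densityMeasure_absolutelyContinuous ρ
  have : NullSingletonClass μ := nullSingletonClass_of_absolutelyContinuous hμac
  have hρm := hρc.measurable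
  set T := monotoneMap μ ν with hT
  have hTm : Measurable T := measurable_monotoneMap μ ν
  have hmap : μ.map T = ν := map_monotoneMap μ ν
  have hscm := (measurable_score ρ).aestronglyMeasurable (μ := μ)
  have hLT : Integrable (fun x => score ρ x * T x) μ :=
    integrable_mul_of_integrable_sq hscm hTm.aestronglyMeasurable hL
      (integrable_monotoneMap_sq h2ν)
  have hLx : Integrable (fun x => score ρ x * x) μ :=
    integrable_mul_of_integrable_sq hscm (by fun_prop) hL h2μ
  have e1 : ∫ x, score ρ x * (T x - x) ∂μ
      = ∫ x, score ρ x * T x ∂μ - ∫ x, score ρ x * x ∂μ := by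
    rw [← integral_sub hLT hLx]
    simp only [mul_sub]
  have hid : -∫ x, score ρ x * x ∂μ ≤ 1 := by
    have heq : (fun x => deriv ρ x * x) =ᵐ[volume] fun x => ρ x * (score ρ x * x) := by
      filter_upwards [ae_deriv_eq_mul_score hρ0 hac] with x hx
      rw [hx, mul_assoc]
    rw [integral_densityMeasure hρ0 hρm, ← integral_congr_ae heq, ← hmass]
    exact neg_integral_deriv_mul_id_le hρ0 hρ1 hac
      (((integrable_densityMeasure hρ0 hρm).1 hLx).congr heq.symm)
  have hνT := integrable_comp_of_map_eq hTm hmap hνi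
  have e2 := integral_comp_of_map_eq hTm hmap hνi.1
  have e3 : ∫ x, (Real.log (lebesgueDensity μ x) - Real.log (lebesgueDensity ν (T x))) ∂μ
      ≤ ∫ x, (deriv T x - 1) ∂μ := by
    refine integral_mono_ae (hμi.sub hνT) (hdi.sub (integrable_const 1)) ?_
    filter_upwards [ae_mongeAmpere_monotoneMap hμac hν] with x hx
    obtain ⟨b1, b2, b3, b4⟩ := hx
    have := Real.log_le_sub_one_of_pos b4
    rw [← b1, Real.log_mul b3.ne' b4.ne']
    linarith
  rw [integral_sub hμi hνT, integral_sub hdi (integrable_const 1), e2, integral_const,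
    probReal_univ, one_smul] at e3
  linarith

end

/-! ### Finite energies -/

/-- The value of `ℰ_ε` on measures of finite energy. -/
noncomputable def energyValue (s lam eps : ℝ) (μ : Measure ℝ) : ℝ :=
  1 / 2 * (∫ p : ℝ × ℝ, rieszKernel s (p.1 - p.2) ∂(μ.prod μ)) + lam / 2 * (∫ x, x ^ 2 ∂μ)
    + eps * ∫ x, Real.log (lebesgueDensity μ x) ∂μ

/-- Absolutely continuous measures with finite second moment, interaction energy and entropy. -/
structure FiniteEnergy (s : ℝ) (μ : Measure ℝ) : Prop where
  sq : Integrable (fun x : ℝ => x ^ 2) μ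
  kernel : Integrable (fun p : ℝ × ℝ => rieszKernel s (p.1 - p.2)) (μ.prod μ)
  ac : μ ≪ volume
  log : Integrable (fun x => Real.log (lebesgueDensity μ x)) μ

lemma regEnergy_eq {s lam eps : ℝ} {μ : Measure ℝ} [IsProbabilityMeasure μ]
    (h : FiniteEnergy s μ) : regEnergy s lam eps μ = (energyValue s lam eps μ : EReal) := by
  rw [regEnergy, entropy_eq_of_integrable h.ac h.log, energy,
    if_pos ⟨h.sq, h.kernel, fun _ x => h.ac (measure_singleton x)⟩, energyValue,
    ← EReal.coe_mul, ← EReal.coe_add]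

lemma finiteEnergy_of_regEnergy_ne_top {s lam eps : ℝ} (heps : 0 < eps) {μ : Measure ℝ}
    [IsProbabilityMeasure μ] (h : regEnergy s lam eps μ ≠ ⊤) : FiniteEnergy s μ := by
  have hE : energy s lam μ ≠ ⊥ := by
    rw [energy]
    split_ifs
    · exact EReal.coe_ne_bot _
    · exact top_ne_bot
  have hH : (eps : EReal) * entropy μ ≠ ⊥ := by
    rw [entropy]
    split_ifs
    · rw [← EReal.coe_mul]
      exact EReal.coe_ne_bot _
    · rw [EReal.coe_mul_top_of_pos heps]
      exact top_ne_bot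
  have h1 : energy s lam μ ≠ ⊤ := fun h' => h (by
    rw [regEnergy, h', EReal.top_add_of_ne_bot hH])
  have h2 : entropy μ ≠ ⊤ := fun h' => h (by
    rw [regEnergy, h', EReal.coe_mul_top_of_pos heps, EReal.add_top_of_ne_bot hE])
  obtain ⟨hac, hlog⟩ := integrable_log_of_entropy_ne_top h2
  rw [energy] at h1
  split_ifs at h1 with hc
  · exact ⟨hc.1, hc.2.1, hac, hlog⟩
  · exact absurd rfl h1

/-! ### Convexity of the energy along the displacement interpolation -/

lemma rieszKernel_convex_comb_le {s : ℝ} (hs0 : 0 < s) (hs1 : s ≤ 1) {a b t : ℝ} (hab : 0 < a * b)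
    (ht0 : 0 < t) (ht1 : t < 1) :
    rieszKernel s ((1 - t) * b + t * a)
      ≤ (1 - t) * rieszKernel s b + t * rieszKernel s a := by
  have hc := (convexOn_rieszKernel hs0 hs1).2
  rcases pos_and_pos_or_neg_and_neg_of_mul_pos hab with ⟨ha, hb⟩ | ⟨ha, hb⟩
  · exact hc (mem_Ioi.2 hb) (mem_Ioi.2 ha) (sub_nonneg.2 ht1.le) ht0.le (sub_add_cancel 1 t)
  · have := hc (mem_Ioi.2 (neg_pos.2 hb)) (mem_Ioi.2 (neg_pos.2 ha)) (sub_nonneg.2 ht1.le)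
      ht0.le (sub_add_cancel 1 t)
    simp only [smul_eq_mul] at this
    have e : (1 - t) * -b + t * -a = -((1 - t) * b + t * a) := by ring
    rwa [e, rieszKernel_neg, rieszKernel_neg, rieszKernel_neg] at this

/-- The energy `ℰ_ε` is `λ`-convex along the displacement interpolation. -/
lemma energyValue_interp_le {s lam eps : ℝ} (hs0 : 0 < s) (hs1 : s ≤ 1) (heps : 0 < eps)
    {μ ν : Measure ℝ} [IsProbabilityMeasure μ] [IsProbabilityMeasure ν]
    (hμ : FiniteEnergy s μ) (hν : FiniteEnergy s ν) {M : ℝ}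
    (hM : ∀ᵐ x ∂μ, lebesgueDensity μ x ≤ M) {t : ℝ} (ht0 : 0 < t) (ht1 : t < 1) :
    FiniteEnergy s (μ.map (interpMap μ ν t)) ∧
      energyValue s lam eps (μ.map (interpMap μ ν t))
        ≤ (1 - t) * energyValue s lam eps ν + t * energyValue s lam eps μ
          - lam / 2 * (t * (1 - t)) * ∫ x, (monotoneMap μ ν x - x) ^ 2 ∂μ := by
  have := nullSingletonClass_of_absolutelyContinuous hμ.ac
  have := nullSingletonClass_of_absolutelyContinuous hν.ac
  set T := monotoneMap μ ν with hT
  have hTm : Measurable T := measurable_monotoneMap μ ν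
  have hmapT : μ.map T = ν := map_monotoneMap μ ν
  have hSm := measurable_interpMap μ ν t
  have hT2 := integrable_monotoneMap_sq (μ := μ) hν.sq
  have hD := integrable_monotoneMap_sub_sq hμ.sq hν.sq
  set μt := μ.map (interpMap μ ν t) with hμt
  have : IsProbabilityMeasure μt := Measure.isProbabilityMeasure_map hSm.aemeasurable
  -- second moments
  have hS2e : ∀ x, interpMap μ ν t x ^ 2
      = (1 - t) * T x ^ 2 - t * (1 - t) * (T x - x) ^ 2 + t * x ^ 2 := fun x => by
    rw [interpMap]
    ring
  have hS2 : Integrable (fun x => interpMap μ ν t x ^ 2) μ := by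
    simp only [hS2e]
    exact ((hT2.const_mul _).sub (hD.const_mul _)).add (hμ.sq.const_mul _)
  have hsq : Integrable (fun x : ℝ => x ^ 2) μt :=
    (integrable_map_measure (by fun_prop) hSm.aemeasurable).2 hS2
  have esq : ∫ x, x ^ 2 ∂μt = (1 - t) * ∫ x, x ^ 2 ∂ν
      - t * (1 - t) * ∫ x, (T x - x) ^ 2 ∂μ + t * ∫ x, x ^ 2 ∂μ := by
    rw [← integral_comp_of_map_eq hSm rfl hsq.1, ← integral_comp_of_map_eq hTm hmapT hν.sq.1,
      ← integral_const_mul, ← integral_const_mul, ← integral_const_mul,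
      ← integral_sub_add (hT2.const_mul _) (hD.const_mul _) (hμ.sq.const_mul _)]
    simp only [hS2e]
    rfl
  -- entropy
  obtain ⟨hlog, hHle⟩ := entropy_interp_le hμ.ac hν.ac hM hμ.log hν.log ht0 ht1 hsq
  -- interaction energy
  have hmap2 : (μ.prod μ).map (Prod.map T T) = ν.prod ν := by
    rw [← Measure.map_prod_map μ μ hTm hTm, hmapT]
  have hmapS : (μ.prod μ).map (Prod.map (interpMap μ ν t) (interpMap μ ν t)) = μt.prod μt := by
    rw [← Measure.map_prod_map μ μ hSm hSm]
  have hSS := hSm.prodMap hSm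
  have hTT := hTm.prodMap hTm
  have hne : ∀ᵐ p ∂(μ.prod μ), 0 < (p.1 - p.2) * (T p.1 - T p.2) := by
    filter_upwards [ae_prod_fst_ne_snd (ν := μ),
      ae_comp_of_map_eq hTT hmap2 (ae_prod_fst_ne_snd (ν := ν)),
      Measure.quasiMeasurePreserving_fst.ae (ae_mem_cdfSupport μ),
      Measure.quasiMeasurePreserving_snd.ae (ae_mem_cdfSupport μ)] with p h1 h2 h3 h4
    simp only [Prod.map_fst, Prod.map_snd] at h2
    rcases lt_or_gt_of_ne h1 with h | h
    · exact mul_pos_of_neg_of_neg (sub_neg.2 h) (sub_neg.2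
        (lt_of_le_of_ne (monotoneOn_monotoneMap μ ν h3 h4 h.le) h2))
    · exact mul_pos (sub_pos.2 h) (sub_pos.2
        (lt_of_le_of_ne (monotoneOn_monotoneMap μ ν h4 h3 h.le) h2.symm))
  have hWle : ∀ᵐ p ∂(μ.prod μ), rieszKernel s (interpMap μ ν t p.1 - interpMap μ ν t p.2)
      ≤ (1 - t) * rieszKernel s (T p.1 - T p.2) + t * rieszKernel s (p.1 - p.2) := by
    filter_upwards [hne] with p hp
    have := rieszKernel_convex_comb_le hs0 hs1 hp ht0 ht1
    convert this using 2
    simp only [interpMap]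
    ring
  have hWT : Integrable (fun p : ℝ × ℝ => rieszKernel s (T p.1 - T p.2)) (μ.prod μ) :=
    integrable_comp_of_map_eq (g := fun p : ℝ × ℝ => rieszKernel s (p.1 - p.2)) hTT hmap2 hν.kernel
  have hup : Integrable (fun p : ℝ × ℝ =>
      (1 - t) * rieszKernel s (T p.1 - T p.2) + t * rieszKernel s (p.1 - p.2)) (μ.prod μ) :=
    (hWT.const_mul _).add (hμ.kernel.const_mul _)
  have hSi : Integrable (interpMap μ ν t) μ :=
    integrable_of_integrable_sq hSm.aestronglyMeasurable hS2
  have hlow : Integrable (fun p : ℝ × ℝ => rieszGrowth s *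
      (1 + |interpMap μ ν t p.1 - interpMap μ ν t p.2|)) (μ.prod μ) :=
    ((integrable_const (1 : ℝ)).add
      ((hSi.comp_fst μ).sub (hSi.comp_snd μ)).abs).const_mul _
  have hWm : Measurable fun p : ℝ × ℝ => rieszKernel s (p.1 - p.2) :=
    (measurable_rieszKernel s).comp (measurable_fst.sub measurable_snd)
  have hWS : Integrable (fun p : ℝ × ℝ =>
      rieszKernel s (interpMap μ ν t p.1 - interpMap μ ν t p.2)) (μ.prod μ) := by
    refine Integrable.mono' (hup.abs.add hlow.abs) (hWm.comp hSS).aestronglyMeasurable ?_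
    filter_upwards [hne, hWle] with p hp hle
    have hz : interpMap μ ν t p.1 - interpMap μ ν t p.2 ≠ 0 := by
      intro h0
      have e : interpMap μ ν t p.1 - interpMap μ ν t p.2
          = (1 - t) * (T p.1 - T p.2) + t * (p.1 - p.2) := by
        simp only [interpMap]
        ring
      rw [e] at h0
      have h1 : 0 < (p.1 - p.2) ^ 2 := by
        refine sq_pos_of_ne_zero fun h => ?_
        rw [h, zero_mul] at hp
        exact lt_irrefl _ hp
      have h2 : (1 - t) * ((p.1 - p.2) * (T p.1 - T p.2)) + t * (p.1 - p.2) ^ 2 = 0 := by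
        linear_combination (p.1 - p.2) * h0
      linarith [mul_pos (sub_pos.2 ht1) hp, mul_pos ht0 h1]
    have h1 := neg_rieszGrowth_le hs0 hs1 hz
    have h2 := le_abs_self ((1 - t) * rieszKernel s (T p.1 - T p.2) + t * rieszKernel s (p.1 - p.2))
    have h3 := le_abs_self (rieszGrowth s *
      (1 + |interpMap μ ν t p.1 - interpMap μ ν t p.2|))
    have h4 := abs_nonneg ((1 - t) * rieszKernel s (T p.1 - T p.2)
      + t * rieszKernel s (p.1 - p.2))
    have h5 := abs_nonneg (rieszGrowth s *
      (1 + |interpMap μ ν t p.1 - interpMap μ ν t p.2|))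
    simp only [Pi.add_apply]
    rw [Real.norm_eq_abs, abs_le]
    constructor <;> linarith
  have hker : Integrable (fun p : ℝ × ℝ => rieszKernel s (p.1 - p.2)) (μt.prod μt) := by
    rw [← hmapS]
    exact (integrable_map_measure hWm.aestronglyMeasurable hSS.aemeasurable).2 hWS
  have eker : ∫ p : ℝ × ℝ, rieszKernel s (p.1 - p.2) ∂(μt.prod μt)
      ≤ (1 - t) * ∫ p : ℝ × ℝ, rieszKernel s (p.1 - p.2) ∂(ν.prod ν)
        + t * ∫ p : ℝ × ℝ, rieszKernel s (p.1 - p.2) ∂(μ.prod μ) := by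
    have e1 := integral_comp_of_map_eq hSS hmapS hker.1
    have e2 := integral_comp_of_map_eq hTT hmap2 hν.kernel.1
    simp only [Prod.map_fst, Prod.map_snd] at e1 e2
    rw [← e1, ← e2, ← integral_const_mul, ← integral_const_mul,
      ← integral_add (hWT.const_mul _) (hμ.kernel.const_mul _)]
    exact integral_mono_ae hWS hup hWle
  refine ⟨⟨hsq, hker, map_interpMap_absolutelyContinuous hμ.ac ht0 ht1, hlog⟩, ?_⟩
  have hHle' := mul_le_mul_of_nonneg_left hHle heps.le
  unfold energyValue
  rw [esq]
  linarith

/-- The Talagrand inequality: compare the minimiser with its displacement interpolations towards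
`μ`. -/
lemma talagrand_of_isRegMinimizer {s lam eps : ℝ} (hs0 : 0 < s) (hs1 : s ≤ 1) (heps : 0 < eps)
    {μ ν : Measure ℝ} [IsProbabilityMeasure μ] [IsProbabilityMeasure ν]
    (hμ : FiniteEnergy s μ) (hν : FiniteEnergy s ν) {M : ℝ}
    (hM : ∀ᵐ x ∂μ, lebesgueDensity μ x ≤ M) (hmin : IsRegMinimizer s lam eps ν) :
    lam / 2 * ∫ x, (monotoneMap μ ν x - x) ^ 2 ∂μ
      ≤ energyValue s lam eps μ - energyValue s lam eps ν := by
  have key : ∀ t, 0 < t → t < 1 →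
      (1 - t) * (lam / 2 * ∫ x, (monotoneMap μ ν x - x) ^ 2 ∂μ)
        ≤ energyValue s lam eps μ - energyValue s lam eps ν := by
    intro t ht0 ht1
    obtain ⟨hf, hle⟩ := energyValue_interp_le (lam := lam) hs0 hs1 heps hμ hν hM ht0 ht1
    have : IsProbabilityMeasure (μ.map (interpMap μ ν t)) :=
      Measure.isProbabilityMeasure_map (measurable_interpMap μ ν t).aemeasurable
    have h1 := hmin.2 _ ⟨this, hf.sq⟩
    rw [regEnergy_eq hf, regEnergy_eq hν, EReal.coe_le_coe_iff] at h1
    refine le_of_mul_le_mul_left ?_ ht0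
    linarith
  have hlim : Tendsto (fun t : ℝ => (1 - t) * (lam / 2 * ∫ x, (monotoneMap μ ν x - x) ^ 2 ∂μ))
      (𝓝[>] 0) (𝓝 (lam / 2 * ∫ x, (monotoneMap μ ν x - x) ^ 2 ∂μ)) := by
    have h : Continuous fun t : ℝ =>
        (1 - t) * (lam / 2 * ∫ x, (monotoneMap μ ν x - x) ^ 2 ∂μ) := by fun_prop
    have := h.tendsto 0
    rw [sub_zero, one_mul] at this
    exact this.mono_left nhdsWithin_le_nhds
  refine le_of_tendsto hlim ?_
  filter_upwards [Ioo_mem_nhdsGT one_pos] with t ht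
  exact key t ht.1 ht.2

/-! ### The HWI inequality for finite dissipation -/

lemma neg_integral_mul_le_sqrt_mul_sqrt {Ω : Type*} [MeasurableSpace Ω] {μ : Measure Ω}
    {f g : Ω → ℝ} (hf : AEStronglyMeasurable f μ) (hg : AEStronglyMeasurable g μ)
    (hf2 : Integrable (fun x => f x ^ 2) μ) (hg2 : Integrable (fun x => g x ^ 2) μ) :
    -∫ x, f x * g x ∂μ ≤ Real.sqrt (∫ x, f x ^ 2 ∂μ) * Real.sqrt (∫ x, g x ^ 2 ∂μ) := by
  have hfg := integrable_mul_of_integrable_sq hf hg hf2 hg2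
  -- the quadratic polynomial `a ↦ ∫ (f + a g)²` is nonnegative
  have hq : ∀ a : ℝ, 0 ≤ (∫ x, g x ^ 2 ∂μ) * (a * a) + (2 * ∫ x, f x * g x ∂μ) * a
      + ∫ x, f x ^ 2 ∂μ := by
    intro a
    have h0 : 0 ≤ ∫ x, (f x + a * g x) ^ 2 ∂μ := integral_nonneg fun x => sq_nonneg _
    have e : ∀ x, (f x + a * g x) ^ 2
        = a * a * g x ^ 2 - -(2 * a) * (f x * g x) + f x ^ 2 := fun x => by ring
    simp only [e] at h0
    rw [integral_sub_add (hg2.const_mul _) (hfg.const_mul _) hf2, integral_const_mul,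
      integral_const_mul] at h0
    linarith
  have hd := discrim_le_zero hq
  rw [discrim] at hd
  have hA : 0 ≤ ∫ x, f x ^ 2 ∂μ := integral_nonneg fun x => sq_nonneg _
  rw [← Real.sqrt_mul hA]
  refine (neg_le_abs _).trans (Real.abs_le_sqrt ?_)
  linarith

/-- The gradient `∂ₓ(-∂ₓₓ)^{-s}ρ + λ x + ε ∂ₓ log ρ` of the first variation of `ℰ_ε` at `ρ`. -/
noncomputable def variationGradient (s lam eps : ℝ) (ρ : ℝ → ℝ) (x : ℝ) : ℝ :=
  deriv (rieszPotential s ρ) x + lam * x + eps * score ρ x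

lemma measurable_variationGradient (s lam eps : ℝ) (ρ : ℝ → ℝ) :
    Measurable (variationGradient s lam eps ρ) :=
  ((measurable_deriv _).add (measurable_id.const_mul _)).add
    ((measurable_score ρ).const_mul _)

lemma dissipation_eq {s lam eps : ℝ} {ρ : ℝ → ℝ} (hρ0 : ∀ x, 0 ≤ ρ x) (hρm : Measurable ρ)
    (h : dissipation s lam eps ρ ≠ ⊤) :
    (∀ a b : ℝ, AbsolutelyContinuousOnInterval ρ a b) ∧
      Integrable (fun x => variationGradient s lam eps ρ x ^ 2) (densityMeasure ρ) ∧
      dissipation s lam eps ρ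
        = ENNReal.ofReal (∫ x, variationGradient s lam eps ρ x ^ 2 ∂(densityMeasure ρ)) := by
  rw [dissipation] at h ⊢
  split_ifs at h ⊢ with hac
  · have hnn : 0 ≤ᵐ[volume] fun x => variationGradient s lam eps ρ x ^ 2 * ρ x :=
      Eventually.of_forall fun x => mul_nonneg (sq_nonneg _) (hρ0 x)
    have hi : Integrable (fun x => variationGradient s lam eps ρ x ^ 2 * ρ x) volume :=
      ⟨(((measurable_variationGradient s lam eps ρ).pow_const 2).mul hρm).aestronglyMeasurable,
        (hasFiniteIntegral_iff_ofReal hnn).2 (lt_top_iff_ne_top.2 h)⟩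
    have hi' : Integrable (fun x => ρ x * variationGradient s lam eps ρ x ^ 2) volume := by
      simpa only [mul_comm] using hi
    refine ⟨hac, (integrable_densityMeasure hρ0 hρm).2 hi', ?_⟩
    rw [integral_densityMeasure hρ0 hρm]
    simp only [mul_comm (ρ _)]
    exact (ofReal_integral_eq_lintegral_ofReal hi hnn).symm
  · exact absurd rfl h

section

variable {s lam eps α C M : ℝ} {ρ : ℝ → ℝ} (hs0 : 0 < s) (hs1 : s ≤ 1) (heps : 0 < eps)
  (hρ0 : ∀ x, 0 ≤ ρ x) (hρc : Continuous ρ) (hρ1 : Integrable ρ volume) (hmass : ∫ x, ρ x = 1)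
  (hM : ∀ x, ρ x ≤ M) (hα : 1 - 2 * s < α) (hC : 0 ≤ C)
  (hHol : ∀ x z, |ρ (x - z) - ρ (x + z)| ≤ C * |z| ^ α)

include hs0 hs1 heps hρ0 hρc hρ1 hmass hM hα hC hHol

/-- The HWI inequality at a density of finite dissipation, with the cost of the monotone map: add
the tangent inequalities for the three parts of the energy and use the Cauchy–Schwarz
inequality. -/
lemma hwi_of_integrable (hac : ∀ a b : ℝ, AbsolutelyContinuousOnInterval ρ a b)
    (hG : Integrable (fun x => variationGradient s lam eps ρ x ^ 2) (densityMeasure ρ))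
    (hμ : FiniteEnergy s (densityMeasure ρ)) {ν : Measure ℝ} [IsProbabilityMeasure ν]
    (hν : FiniteEnergy s ν) :
    energyValue s lam eps (densityMeasure ρ) - energyValue s lam eps ν
      ≤ Real.sqrt (∫ x, variationGradient s lam eps ρ x ^ 2 ∂(densityMeasure ρ))
          * Real.sqrt (∫ x, (monotoneMap (densityMeasure ρ) ν x - x) ^ 2 ∂(densityMeasure ρ))
        - lam / 2 * ∫ x, (monotoneMap (densityMeasure ρ) ν x - x) ^ 2 ∂(densityMeasure ρ) := by
  have hρm := hρc.measurable
  set μ := densityMeasure ρ with hμdef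
  have : IsProbabilityMeasure μ := isProbabilityMeasure_densityMeasure hρ0 hρ1 hmass
  have := nullSingletonClass_of_absolutelyContinuous hμ.ac
  have := nullSingletonClass_of_absolutelyContinuous hν.ac
  have hx1 : Integrable (fun x : ℝ => x) μ := integrable_of_integrable_sq (by fun_prop) hμ.sq
  have hx1ν : Integrable (fun x : ℝ => x) ν := integrable_of_integrable_sq (by fun_prop) hν.sq
  have hderiv : ∀ᵐ x ∂μ, deriv (rieszPotential s ρ) x = rieszField s ρ x :=
    hμ.ac.ae_le (ae_deriv_rieszPotential hs0 hs1 hρ0 hρm hρ1 hmass hM hx1 hα hC hHol)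
  obtain ⟨B, hB⟩ := exists_abs_rieszField_le hs0 hs1 hρ0 hρm hρ1 hα hC hHol
  have hqm := measurable_rieszField hs0 hs1 hρ0 hρm hρ1 hmass hx1 hα hC hHol
  have hGm := measurable_variationGradient s lam eps ρ
  have hscm := measurable_score ρ
  -- the potential has a bounded derivative, so that finite dissipation implies finite Fisher
  -- information
  have hL : Integrable (fun x => score ρ x ^ 2) μ := by
    rw [← memLp_two_iff_integrable_sq hscm.aestronglyMeasurable]
    have m1 : MemLp (variationGradient s lam eps ρ) 2 μ :=
      (memLp_two_iff_integrable_sq hGm.aestronglyMeasurable).2 hG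
    have m2 : MemLp (rieszField s ρ) 2 μ :=
      MemLp.of_bound hqm.aestronglyMeasurable B (Eventually.of_forall hB)
    have m3 : MemLp (fun x : ℝ => x) 2 μ := (memLp_two_iff_integrable_sq (by fun_prop)).2 hμ.sq
    refine (((m1.sub m2).sub (m3.const_mul lam)).const_mul eps⁻¹).ae_eq ?_
    filter_upwards [hderiv] with x hx
    simp only [Pi.sub_apply, variationGradient, hx]
    field_simp
    ring
  set T := monotoneMap μ ν with hT
  have hTm : Measurable T := measurable_monotoneMap μ ν
  have hT2 : Integrable (fun x => T x ^ 2) μ := integrable_monotoneMap_sq hν.sq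
  have hD : Integrable (fun x => (T x - x) ^ 2) μ := integrable_monotoneMap_sub_sq hμ.sq hν.sq
  have hξm : AEStronglyMeasurable (fun x => T x - x) μ :=
    (hTm.sub measurable_id).aestronglyMeasurable
  have hξ : Integrable (fun x => T x - x) μ := integrable_of_integrable_sq hξm hD
  have h1 := interaction_tangent_le hs0 hs1 hρ0 hρm hρ1 hmass hM hx1 hα hC hHol hx1ν hν.kernel
  have h2 := mul_le_mul_of_nonneg_left
    (entropy_tangent_le hρ0 hρc hρ1 hmass hac hL hν.ac hμ.sq hν.sq hμ.log hν.log) heps.le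
  rw [← hμdef, ← hT] at h1 h2
  have i1 : Integrable (fun x => (T x - x) * rieszField s ρ x) μ :=
    hξ.mul_bdd hqm.aestronglyMeasurable (Eventually.of_forall hB)
  have i2 : Integrable (fun x => x * (T x - x)) μ :=
    integrable_mul_of_integrable_sq (by fun_prop) hξm hμ.sq hD
  have i3 : Integrable (fun x => score ρ x * (T x - x)) μ :=
    integrable_mul_of_integrable_sq hscm.aestronglyMeasurable hξm hL hD
  have e3 : ∫ x, x ^ 2 ∂ν = ∫ x, x ^ 2 ∂μ - -2 * ∫ x, x * (T x - x) ∂μ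
      + ∫ x, (T x - x) ^ 2 ∂μ := by
    rw [← integral_comp_of_map_eq hTm (map_monotoneMap μ ν) hν.sq.1, ← integral_const_mul,
      ← integral_sub_add hμ.sq (i2.const_mul _) hD]
    refine integral_congr_ae (Eventually.of_forall fun x => ?_)
    ring
  have e4 : ∫ x, variationGradient s lam eps ρ x * (T x - x) ∂μ
      = ∫ x, (T x - x) * rieszField s ρ x ∂μ + lam * ∫ x, x * (T x - x) ∂μ
        + eps * ∫ x, score ρ x * (T x - x) ∂μ := by
    have hi12 : Integrable (fun x => (T x - x) * rieszField s ρ x + lam * (x * (T x - x))) μ :=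
      i1.add (i2.const_mul lam)
    rw [← integral_const_mul, ← integral_const_mul, ← integral_add i1 (i2.const_mul lam),
      ← integral_add hi12 (i3.const_mul eps)]
    refine integral_congr_ae ?_
    filter_upwards [hderiv] with x hx
    rw [variationGradient, hx]
    ring
  have h4 := neg_integral_mul_le_sqrt_mul_sqrt hGm.aestronglyMeasurable hξm hG hD
  rw [e4] at h4
  unfold energyValue
  rw [e3]
  linarith

end

end FracPressure

open FracPressure
theorem mainTheorem3 (s lam eps : ℝ) (hs0 : 0 < s) (hs1 : s ≤ 1) (hlam : 0 < lam)
    (heps0 : 0 < eps) (heps1 : eps < lam / (2 * Real.pi))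
    (α : ℝ≥0) (hα : 1 - 2 * s < (α : ℝ))
    (ρ : ℝ → ℝ) (hρ0 : ∀ x, 0 ≤ ρ x) (hρ1 : Integrable ρ volume) (hρinf : MemLp ρ ∞ volume)
    (hρcont : Continuous ρ) (hρα : MemHolder α ρ)
    (hmass : ∫ x, ρ x = 1) (hmom : Integrable (fun x => x ^ 2 * ρ x) volume)
    (μinf : Measure ℝ) (hmin : IsRegMinimizer s lam eps μinf) :
    -- the energies are finite, so that their difference makes sense
    (regEnergy s lam eps (densityMeasure ρ) ≠ ⊤ ∧ regEnergy s lam eps μinf ≠ ⊤) ∧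
    -- HWI inequality
    regEnergy s lam eps (densityMeasure ρ) - regEnergy s lam eps μinf
      ≤ ((dissipation s lam eps ρ ^ (1 / 2 : ℝ) * W2 (densityMeasure ρ) μinf : ℝ≥0∞) : EReal)
        - ((ENNReal.ofReal (lam / 2) * W2 (densityMeasure ρ) μinf ^ 2 : ℝ≥0∞) : EReal) ∧
    -- logarithmic Sobolev inequality
    regEnergy s lam eps (densityMeasure ρ) - regEnergy s lam eps μinf
      ≤ ((ENNReal.ofReal (1 / (2 * lam)) * dissipation s lam eps ρ : ℝ≥0∞) : EReal) ∧
    -- Talagrand inequality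
    W2 (densityMeasure ρ) μinf
      ≤ ENNReal.ofReal (Real.sqrt ((2 / lam) *
          (regEnergy s lam eps (densityMeasure ρ) - regEnergy s lam eps μinf).toReal)) := by
  have hρm := hρcont.measurable
  -- a bound and a symmetrised Hölder bound for the density
  obtain ⟨M, hM⟩ : ∃ M, ∀ x, ρ x ≤ M := by
    refine ⟨(eLpNorm ρ ∞ volume).toReal, fun x => ?_⟩
    have hae : (fun x => min (ρ x) (eLpNorm ρ ∞ volume).toReal) =ᵐ[volume] ρ := by
      filter_upwards [ae_le_eLpNormEssSup (f := ρ) (μ := volume)] with x hx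
      refine min_eq_left ((le_abs_self _).trans ?_)
      have h := ENNReal.toReal_mono hρinf.2.ne
        (hx.trans_eq (eLpNorm_exponent_top (f := ρ) (μ := volume)).symm)
      rwa [toReal_enorm] at h
    have heq := (Continuous.ae_eq_iff_eq volume (by fun_prop) hρcont).1 hae
    rw [← congrFun heq x]
    exact min_le_right _ _
  obtain ⟨C, hC, hHol⟩ : ∃ C : ℝ, 0 ≤ C ∧
      ∀ x z, |ρ (x - z) - ρ (x + z)| ≤ C * |z| ^ (α : ℝ) := by
    obtain ⟨K, hK⟩ := hρα
    refine ⟨K * 2 ^ (α : ℝ), by positivity, fun x z => ?_⟩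
    have h := hK.dist_le (x - z) (x + z)
    have e : x - z - (x + z) = -(2 * z) := by ring
    rw [Real.dist_eq, Real.dist_eq, e, abs_neg, abs_mul, abs_two,
      Real.mul_rpow zero_le_two (abs_nonneg z), ← mul_assoc] at h
    exact h
  -- both measures have finite energy
  set μ := densityMeasure ρ with hμdef
  have : IsProbabilityMeasure μ := isProbabilityMeasure_densityMeasure hρ0 hρ1 hmass
  have : IsProbabilityMeasure μinf := hmin.1.1
  have hμac : μ ≪ volume := densityMeasure_absolutelyContinuous ρ
  have hsq : Integrable (fun x : ℝ => x ^ 2) μ := by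
    rw [hμdef, integrable_densityMeasure hρ0 hρm]
    simpa only [mul_comm] using hmom
  have hx1 : Integrable (fun x : ℝ => x) μ := integrable_of_integrable_sq (by fun_prop) hsq
  have hMd : ∀ᵐ x ∂μ, lebesgueDensity μ x ≤ M := by
    filter_upwards [hμac.ae_le (lebesgueDensity_densityMeasure hρ0 hρm)] with x hx
    rw [hμdef, hx]
    exact hM x
  have hμf : FiniteEnergy s μ :=
    ⟨hsq, integrable_rieszKernel_prod (densityMeasure_le hM) hs0 hs1 hx1, hμac,
      integrable_log_lebesgueDensity hμac hMd hsq⟩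
  have hEμ := regEnergy_eq (lam := lam) (eps := eps) hμf
  have htop : regEnergy s lam eps μ ≠ ⊤ := by
    rw [hEμ]
    exact EReal.coe_ne_top _
  have htopν : regEnergy s lam eps μinf ≠ ⊤ :=
    ne_top_of_le_ne_top htop (hmin.2 μ ⟨inferInstance, hsq⟩)
  have hνf : FiniteEnergy s μinf := finiteEnergy_of_regEnergy_ne_top heps0 htopν
  have hEν := regEnergy_eq (lam := lam) (eps := eps) hνf
  have := nullSingletonClass_of_absolutelyContinuous hμac
  have := nullSingletonClass_of_absolutelyContinuous hνf.ac
  have hW2 := W2_eq_ofReal_sqrt hsq hνf.sq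
  have hD := integrable_monotoneMap_sub_sq hsq hνf.sq
  have htal := talagrand_of_isRegMinimizer hs0 hs1 heps0 hμf hνf hMd hmin
  set D := ∫ x, (monotoneMap μ μinf x - x) ^ 2 ∂μ with hDdef
  have hD0 : 0 ≤ D := integral_nonneg fun x => sq_nonneg _
  have hW2sq : ENNReal.ofReal (lam / 2) * W2 μ μinf ^ 2 = ENNReal.ofReal (lam / 2 * D) := by
    rw [hW2, ← ENNReal.ofReal_pow (Real.sqrt_nonneg _), Real.sq_sqrt hD0,
      ← ENNReal.ofReal_mul (by positivity)]
  have hcoe : ∀ {x : ℝ}, 0 ≤ x → ((ENNReal.ofReal x : ℝ≥0∞) : EReal) = (x : EReal) :=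
    fun hx => by rw [EReal.coe_ennreal_ofReal, max_eq_left hx]
  refine ⟨⟨htop, htopν⟩, ?_⟩
  rw [hEμ, hEν, ← EReal.coe_sub, EReal.toReal_coe, hW2sq, hcoe (x := lam / 2 * D) (by positivity)]
  refine ⟨?_, ?_, ?_⟩
  · by_cases hI : dissipation s lam eps ρ = ⊤
    · rcases hD0.eq_or_lt with h0 | hpos
      · -- distance zero: the monotone map is the identity, and the two measures agree
        have hid : ∀ᵐ x ∂μ, monotoneMap μ μinf x = x := by
          have := (integral_eq_zero_iff_of_nonneg (fun x => sq_nonneg _) hD).1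
            (hDdef.symm.trans h0.symm)
          filter_upwards [this] with x hx
          exact sub_eq_zero.1 (pow_eq_zero_iff two_ne_zero |>.1 hx)
        have heq : μ = μinf := by
          rw [← map_monotoneMap μ μinf, Measure.map_congr hid]
          exact Measure.map_id.symm
        rw [hW2, ← h0, Real.sqrt_zero, ENNReal.ofReal_zero, mul_zero, mul_zero, ← heq, sub_self]
        simp
      · have hne : W2 μ μinf ≠ 0 := by
          rw [hW2]
          exact (ENNReal.ofReal_pos.2 (Real.sqrt_pos.2 hpos)).ne'
        rw [hI, ENNReal.top_rpow_of_pos (by norm_num), ENNReal.top_mul hne,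
          EReal.coe_ennreal_top, EReal.top_sub_coe]
        exact le_top
    · obtain ⟨hac, hG, hIe⟩ := dissipation_eq hρ0 hρm hI
      have := hwi_of_integrable hs0 hs1 heps0 hρ0 hρcont hρ1 hmass hM hα hC hHol hac hG hμf hνf
      rw [hIe, hW2, ENNReal.ofReal_rpow_of_nonneg (integral_nonneg fun x => sq_nonneg _)
        (by norm_num), ← Real.sqrt_eq_rpow, ← ENNReal.ofReal_mul (Real.sqrt_nonneg _),
        hcoe (by positivity), ← EReal.coe_sub, EReal.coe_le_coe_iff]
      exact this
  · by_cases hI : dissipation s lam eps ρ = ⊤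
    · rw [hI, ENNReal.mul_top (ENNReal.ofReal_pos.2 (by positivity)).ne', EReal.coe_ennreal_top]
      exact le_top
    · obtain ⟨hac, hG, hIe⟩ := dissipation_eq hρ0 hρm hI
      have h1 := hwi_of_integrable hs0 hs1 heps0 hρ0 hρcont hρ1 hmass hM hα hC hHol hac hG hμf hνf
      have hA : 0 ≤ ∫ x, variationGradient s lam eps ρ x ^ 2 ∂μ :=
        integral_nonneg fun x => sq_nonneg _
      rw [hIe, ← ENNReal.ofReal_mul (by positivity), hcoe (by positivity), EReal.coe_le_coe_iff]
      refine h1.trans ?_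
      rw [← hμdef, ← hDdef]
      -- Young's inequality
      have hsA := Real.sq_sqrt hA
      have hsD := Real.sq_sqrt hD0
      rw [one_div, inv_mul_eq_div, le_div_iff₀ (by positivity)]
      have hy := sq_nonneg (Real.sqrt (∫ x, variationGradient s lam eps ρ x ^ 2 ∂μ)
        - lam * Real.sqrt D)
      rw [sub_sq, mul_pow, hsA, hsD] at hy
      linarith
  · rw [hW2]
    refine ENNReal.ofReal_le_ofReal (Real.sqrt_le_sqrt ?_)
    rw [div_mul_eq_mul_div, le_div_iff₀ hlam]
    linarith
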